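/- **Setting.** Consider the state-space model $x_t=\mathcal M_{t-1}(x_{t-1})+\eta_t$, $y_t=\mathcal H_t(x_t)+\varepsilon_t$ ($t=1,\dots,T$), with $x_t\in\mathbb R^d$, measurable $\mathcal M_t,\mathcal H_t$, and independent noises with Lebesgue densities $p_{\eta_t},p_{\varepsilon_t}$. Fix observations $y_1,\dots,y_T$. Let $P_t$ (prior) and $Q_t$ (posterior) be the laws of $x_t$ given $y_{1:t-1}$ and given $y_{1:t}$: $Q_0$ is the law of $x_0$, $P_{t+1}$ is the law of $\mathcal M_t(x)+\eta_{t+1}$ with $x\sim Q_t$ independent of $\eta_{t+1}$, and $dQ_t/dP_t\propto p_{\varepsilon_t}(y_t-\mathcal H_t(\cdot))$, where $\int p_{\varepsilon_t}(y_t-\mathcal H_t)\,dP_t>0$. Let $w_t(x)=c_t\,p_{\varepsilon_t}(y_t-\mathcal H_t(x))$, with constants $c_t>0$, be the importance weights, and $\mathbb E w_t=\int w_t\,dP_t$. Let $\mathcal F_D$ be a class of test functions $\mathbb R^d\to\mathbb R$. **Assumptions.** For all $t=1,\dots,T$: (1) $\mathcal M_t,\mathcal H_t$ are continuous and $p_{\eta_t},p_{\varepsilon_t}$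 are $C^1$; (2) $\|w_t\|_\infty\le B$, and $\|f\|_\infty\le B$ for all $f\in\mathcal F_D$; (3) $\eta_t,\varepsilon_t$ have finite second moments; (4) $w_t$ and every $f\in\mathcal F_D$ are differentiable with gradients of Euclidean norm at most $\beta$, where $\beta>0$; (5) $P_t$ is strongly log-concave with parameter $\gamma_t>0$, i.e. it has a density $e^{-\psi}$ on a convex set (and $0$ outside) where $\psi$ is strongly convex with parameter $\gamma_t$. **Notation.** Fix $t\in\{1,\dots,T\}$, a probability measure $\hat P_t$ on $\mathbb R^d$ and a pointwise measurable class $\mathcal G_t$ of maps $\mathbb R^d\to\mathbb R^d$ (all maps are measurable, and every one is the pointwise limit of a sequence from a fixed countable subclass; any class of continuous maps qualifies). Let $x_1,\dots,x_{N_1}$ be i.i.d. from $\hat P_t$ and $x'_1,\dots,x'_{N_2}$ i.i.d. from $P_t$, $N_1,N_2\ge1$. For $G\in\mathcal G_t$ put $$\mathrm{MMD}(G)=\sup_{f\in\mathcal F_D}\Big|\mathbb E_{x\sim\hat P_t}f(G(x))-\mathbb E_{Q_t}f\Big|,\qquad \widehat{\mathrm{MMD}}(G)=\sup_{f\in\mathcal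 F_D}\Big|\frac1{N_1}\sum_{i=1}^{N_1} f(G(x_i))-\sum_{j=1}^{N_2}\frac{w_t(x'_j)}{\sum_{l} w_t(x'_l)}f(x'_j)\Big|,$$ and $\chi^2=\int(dQ_t/dP_t-1)^2\,dP_t$. Let $\mathscr N_\infty(r,\mathcal F_D)\in\{0,1,2,\dots,\infty\}$ be the covering number of $\mathcal F_D$ (closed balls of radius $r$ with centres in the class) in the sup norm, $\mathscr N_1(r,\mathcal H,X)$ that of a class $\mathcal H$ in the empirical metric $\frac1{N_1}\sum_i\|g(x_i)-h(x_i)\|$, and $\mathbb E\mathscr N_1(r,\mathcal H)$ its expectation over $x_1,\dots,x_{N_1}$. Put $\mathcal F_D\circ\mathcal G_t=\{f\circ g: f\in\mathcal F_D,\ g\in\mathcal G_t\}$. **(a)** For every $N_1,N_2\ge 1$ and $\varepsilon>0$, $$\mathbb P\Big(\sup_{G\in\mathcal G_t}\big|\mathrm{MMD}(G)-\widehat{\mathrm{MMD}}(G)\big|>\varepsilon+\tfrac{12B(\chi^2+1)}{N_2}\Big)\le 2\mathscr N_\infty(\tfrac\varepsilon6,\mathcal F_D)e^{-\frac{\gamma_tN_2(\mathbb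 Ew_t)^2\varepsilon^2}{5760B^2\beta^2}}+2e^{-\frac{N_2(\mathbb Ew_t)^2}{2B^2}}+8\,\mathbb E\mathscr N_1(\tfrac\varepsilon{16},\mathcal F_D\circ\mathcal G_t)\,e^{-\frac{N_1\varepsilon^2}{2048B^2}},$$ and the right-hand side is at most $$2\mathscr N_\infty(\tfrac\varepsilon6,\mathcal F_D)e^{-\frac{\gamma_tN_2(\mathbb Ew_t)^2\varepsilon^2}{5760B^2\beta^2}}+2e^{-\frac{N_2(\mathbb Ew_t)^2}{2B^2}}+8\,\mathscr N_\infty(\tfrac\varepsilon{32},\mathcal F_D)\,\mathbb E\mathscr N_1(\tfrac\varepsilon{32\beta},\mathcal G_t)\,e^{-\frac{N_1\varepsilon^2}{2048B^2}}.$$ **(b)** Put $$R_\delta(\varepsilon)=\Big(\frac{64B\beta}{\sqrt{\gamma_t}\,\mathbb Ew_t}\sqrt{\frac{\log\mathscr N_\infty(\frac\varepsilon6,\mathcal F_D)}{N_2}}+64B\sqrt{\frac{\log\mathscr N_\infty(\frac\varepsilon{32},\mathcal F_D)+\log\mathbb E\mathscr N_1(\frac\varepsilon{32\beta},\mathcal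 G_t)}{N_1}}\Big)\sqrt{\log\tfrac3\delta}.$$ Suppose that $\mathcal F_D$ has at least two elements. For every $\delta>0$ there are $N_1(\delta),N_2(\delta)$ such that the following holds for all $N_1\ge N_1(\delta)$ and $N_2\ge N_2(\delta)$. Let $\varepsilon(\delta)>0$ be a solution of $\varepsilon=R_\delta(\varepsilon)$, or, more generally, any $\varepsilon>0$ with $\varepsilon\le R_\delta(\varepsilon)$ for which the covering quantities in $R_\delta(\varepsilon)$ are finite. Then, with probability at least $1-\delta$, simultaneously for all $G\in\mathcal G_t$, $$\mathrm{MMD}(G)\le\widehat{\mathrm{MMD}}(G)+\frac{12B(\chi^2+1)}{N_2}+R_\delta(\varepsilon(\delta)),$$ and every minimizer $\hat G_t$ of $\widehat{\mathrm{MMD}}$ over $\mathcal G_t$ satisfies $$\mathrm{MMD}(\hat G_t)\le\inf_{G\in\mathcal G_t}\mathrm{MMD}(G)+\frac{24B(\chi^2+1)}{N_2}+2R_\delta(\varepsilon(\delta)).$$ -/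

import Mathlib

open MeasureTheory ProbabilityTheory Filter
open scoped ENNReal NNReal Topology

universe u

namespace ATPF

noncomputable section

/-! ### State-space models and the filtering recursion -/

/-- The Euclidean space `ℝ^d`. -/
abbrev Euc (d : ℕ) := EuclideanSpace ℝ (Fin d)

/-- `p` is a probability density with respect to Lebesgue measure. -/
structure IsDensity {d : ℕ} (p : Euc d → ℝ) : Prop where
  measurable : Measurable p
  nonneg : ∀ x, 0 ≤ p x
  lintegral_eq_one : ∫⁻ x, ENNReal.ofReal (p x) = 1

/-- The data of the state-space model
`x_{t+1} = M_t(x_t) + η_{t+1}`, `y_t = H_t(x_t) + ε_t`, with independent noises that have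
densities `pη_t` and `pε_t`; the state space is `ℝ^d` and `y_t` lives in `ℝ^{k t}`. -/
structure StateSpaceModel (d : ℕ) (k : ℕ → ℕ) where
  /-- law of `x_0` -/
  init : Measure (Euc d)
  isProbabilityMeasure_init : IsProbabilityMeasure init
  /-- evolution operators -/
  M : ℕ → Euc d → Euc d
  measurable_M : ∀ t, Measurable (M t)
  /-- observation operators -/
  H : (t : ℕ) → Euc d → Euc (k t)
  measurable_H : ∀ t, Measurable (H t)
  /-- densities of the evolution noises -/
  pη : ℕ → Euc d → ℝ
  isDensity_pη : ∀ t, IsDensity (pη t)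
  /-- densities of the observation noises -/
  pε : (t : ℕ) → Euc (k t) → ℝ
  isDensity_pε : ∀ t, IsDensity (pε t)

/-- Bayes' rule: the measure with density `ℓ / ∫ ℓ dP` with respect to `P`. -/
def bayes {d : ℕ} (P : Measure (Euc d)) (ℓ : Euc d → ℝ) : Measure (Euc d) :=
  (∫⁻ x, ENNReal.ofReal (ℓ x) ∂P)⁻¹ • P.withDensity (fun x => ENNReal.ofReal (ℓ x))

namespace StateSpaceModel

variable {d : ℕ} {k : ℕ → ℕ}

/-- The likelihood `x ↦ p_{ε_t}(y_t - H_t(x))` of the observation `y_t`. -/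
def likelihood (S : StateSpaceModel d k) (y : (t : ℕ) → Euc (k t)) (t : ℕ) (x : Euc d) : ℝ :=
  S.pε t (y t - S.H t x)

/-- Forecast step: the law of `M_t(x) + η_{t+1}` with `x ∼ Q` and `η_{t+1}` independent. -/
def forecast (S : StateSpaceModel d k) (t : ℕ) (Q : Measure (Euc d)) : Measure (Euc d) :=
  (Q.map (S.M t)) ∗ (volume.withDensity fun x => ENNReal.ofReal (S.pη (t + 1) x))

/-- The posterior `Q_t`, the law of `x_t` given `y_1, …, y_t`. -/
def posterior (S : StateSpaceModel d k) (y : (t : ℕ) → Euc (k t)) : ℕ → Measure (Euc d)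
  | 0 => S.init
  | t + 1 => bayes (S.forecast t (posterior S y t)) (S.likelihood y (t + 1))

/-- The prior `P_t`, the law of `x_t` given `y_1, …, y_{t-1}`. -/
def prior (S : StateSpaceModel d k) (y : (t : ℕ) → Euc (k t)) : ℕ → Measure (Euc d)
  | 0 => S.init
  | t + 1 => S.forecast t (S.posterior y t)

/-- The weight function `w_t(x) = c_t p_{ε_t}(y_t - H_t(x))`, where the constant `c_t` is the weight
that the (resampled) prior particles carry before the analysis step at time `t`. -/
def weight (S : StateSpaceModel d k) (y : (t : ℕ) → Euc (k t)) (c : ℕ → ℝ) (t : ℕ) (x : Euc d) :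
    ℝ :=
  c t * S.likelihood y t x

end StateSpaceModel

/-- `P` is strongly log-concave with parameter `γ`: it has the Lebesgue density `exp (-ψ)` on a
convex set `K` (and `0` outside), where `ψ` is strongly convex on `K` with parameter `γ`. -/
def IsStronglyLogConcave {d : ℕ} (P : Measure (Euc d)) (γ : ℝ) : Prop :=
  ∃ (K : Set (Euc d)) (ψ : Euc d → ℝ), StrongConvexOn K γ ψ ∧
    P = (volume.restrict K).withDensity (fun x => ENNReal.ofReal (Real.exp (-ψ x)))

/-- The standing assumptions on the model, on the class `F` of test functions, on the common bound
`B`, on the Lipschitz constant `β` and on the log-concavity parameters `γ_1, …, γ_T`. -/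
structure Assumptions {d : ℕ} {k : ℕ → ℕ} (S : StateSpaceModel d k) (y : (t : ℕ) → Euc (k t))
    (c : ℕ → ℝ) (T : ℕ) (F : Set (Euc d → ℝ)) (B β : ℝ) (γ : ℕ → ℝ) : Prop where
  /- continuity and differentiability -/
  continuous_M : ∀ t ∈ Set.Icc 1 T, Continuous (S.M t)
  continuous_H : ∀ t ∈ Set.Icc 1 T, Continuous (S.H t)
  contDiff_pη : ∀ t ∈ Set.Icc 1 T, ContDiff ℝ 1 (S.pη t)
  contDiff_pε : ∀ t ∈ Set.Icc 1 T, ContDiff ℝ 1 (S.pε t)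
  /- bounded weights and test functions -/
  weight_le : ∀ t ∈ Set.Icc 1 T, ∀ x, |S.weight y c t x| ≤ B
  test_le : ∀ f ∈ F, ∀ x, |f x| ≤ B
  /- finite second moments of the noises -/
  secondMoment_η : ∀ t ∈ Set.Icc 1 T, Integrable (fun x => ‖x‖ ^ 2 * S.pη t x) volume
  secondMoment_ε : ∀ t ∈ Set.Icc 1 T, Integrable (fun x => ‖x‖ ^ 2 * S.pε t x) volume
  /- smoothness -/
  differentiable_test : ∀ f ∈ F, Differentiable ℝ f
  differentiable_weight : ∀ t ∈ Set.Icc 1 T, Differentiable ℝ (S.weight y c t)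
  gradient_test_le : ∀ f ∈ F, ∀ x, ‖gradient f x‖ ≤ β
  gradient_weight_le : ∀ t ∈ Set.Icc 1 T, ∀ x, ‖gradient (S.weight y c t) x‖ ≤ β
  /- strong log-concavity of the priors -/
  gamma_pos : ∀ t ∈ Set.Icc 1 T, 0 < γ t
  stronglyLogConcave : ∀ t ∈ Set.Icc 1 T, IsStronglyLogConcave (S.prior y t) (γ t)

/-! ### Discrepancies and samples -/

/-- The χ² divergence `∫ (dQ/dP - 1)² dP` (for `Q ≪ P`). -/
def chiSq {E : Type*} [MeasurableSpace E] (Q P : Measure E) : ℝ :=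
  ∫ x, ((Q.rnDeriv P x).toReal - 1) ^ 2 ∂P

/-- The maximum mean discrepancy `sup_{f ∈ F} |E_P f - E_Q f|`. -/
def mmd {E : Type*} [MeasurableSpace E] (F : Set (E → ℝ)) (P Q : Measure E) : ℝ :=
  ⨆ f : F, |∫ x, f.1 x ∂P - ∫ x, f.1 x ∂Q|

/-- The empirical maximum mean discrepancy of `g`, with the self-normalised importance sampling
estimate of the posterior expectation built from the weights `w` and the particles `x'`. -/
def empMMD {E : Type*} (F : Set (E → ℝ)) (w : E → ℝ) (g : E → E) {N₁ N₂ : ℕ}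
    (x : Fin N₁ → E) (x' : Fin N₂ → E) : ℝ :=
  ⨆ f : F, |(1 / (N₁ : ℝ)) * ∑ i, f.1 (g (x i)) - ∑ j, w (x' j) / (∑ l, w (x' l)) * f.1 (x' j)|

/-- `X_1, …, X_n` are i.i.d. with law `P` under `μ`. -/
structure IsIIDSample {Ω E : Type*} [MeasurableSpace Ω] [MeasurableSpace E] (μ : Measure Ω)
    {n : ℕ} (X : Fin n → Ω → E) (P : Measure E) : Prop where
  measurable : ∀ i, Measurable (X i)
  indep : iIndepFun X μ
  law : ∀ i, μ.map (X i) = P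

/-- A pointwise measurable class of maps: a countable subclass is dense for pointwise sequential
convergence. (This makes suprema over the class measurable; every class of continuous maps of
`ℝ^d` has this property.) -/
def IsPointwiseMeasurable {E V : Type*} [MeasurableSpace E] [TopologicalSpace V]
    [MeasurableSpace V] (G : Set (E → V)) : Prop :=
  (∀ g ∈ G, Measurable g) ∧
    ∃ G₀ ⊆ G, G₀.Countable ∧
      ∀ g ∈ G, ∃ u : ℕ → E → V, (∀ n, u n ∈ G₀) ∧ ∀ x, Tendsto (fun n => u n x) atTop (𝓝 (g x))

/-! ### Covering numbers -/

/-- The `L_∞` covering number `𝒩_∞(ε, F)`: the least number of closed sup-norm balls of radius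
`ε`, centred in `F`, that cover `F`. -/
def supCover {E : Type*} (ε : ℝ) (F : Set (E → ℝ)) : ℝ≥0∞ :=
  ((Metric.coveringNumber ε.toNNReal (UniformFun.ofFun '' F) : ℕ∞) : ℝ≥0∞)

/-- The empirical `l_1` covering number `𝒩_1(ε, G, x)`: the least number of closed balls of radius
`ε`, centred in `G`, that cover `G` in the metric `(g, h) ↦ (1/n) ∑ i, ‖g (x_i) - h (x_i)‖`. -/
def empCover {E V : Type*} [NormedAddCommGroup V] [NormedSpace ℝ V] {n : ℕ} (ε : ℝ)
    (G : Set (E → V)) (x : Fin n → E) : ℝ≥0∞ :=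
  ((Metric.coveringNumber ε.toNNReal
    ((fun g : E → V => (1 / (n : ℝ)) • WithLp.toLp 1 (fun i => g (x i))) '' G :
      Set (PiLp 1 fun _ : Fin n => V)) : ℕ∞) : ℝ≥0∞)

/-- The expected empirical covering number `E 𝒩_1(ε, G, X^{1:n})`, `X_i` i.i.d. with law `P`. -/
def expCover {E V : Type*} [MeasurableSpace E] [NormedAddCommGroup V] [NormedSpace ℝ V]
    (P : Measure E) (n : ℕ) (ε : ℝ) (G : Set (E → V)) : ℝ≥0∞ :=
  ∫⁻ x, empCover ε G x ∂(Measure.pi fun _ : Fin n => P)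

/-- The class `F ∘ G` of all compositions. -/
def compClass {E : Type*} (F : Set (E → ℝ)) (G : Set (E → E)) : Set (E → ℝ) :=
  Set.image2 (fun f g => f ∘ g) F G

/-- The statistical error
`(64Bβ/(√γ m) √(log 𝒩_∞(ε/6,F)/N₂) + 64B √((log 𝒩_∞(ε/32,F) + log E𝒩_1(ε/(32β),G))/N₁)) √(log(3/δ))`.
-/
def statError {E : Type*} [MeasurableSpace E] [NormedAddCommGroup E] [NormedSpace ℝ E]
    (F : Set (E → ℝ)) (G : Set (E → E)) (P : Measure E) (B β γ m : ℝ) (N₁ N₂ : ℕ) (δ ε : ℝ) : ℝ :=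
  (64 * B * β / (√γ * m) * √(Real.log (supCover (ε / 6) F).toReal / N₂) +
    64 * B * √((Real.log (supCover (ε / 32) F).toReal +
      Real.log (expCover P N₁ (ε / (32 * β)) G).toReal) / N₁)) * √(Real.log (3 / δ))

end

end ATPF

/-! Both discrepancies are suprema over the same test functions, so their gap is at most the sum of
two uniform errors: that of the empirical mean of `f ∘ g` under `Phat`, and that of the
self-normalised importance sampling estimate of the posterior mean of `f` (`abs_mmd_sub_empMMD_le`).
Each error gets its own tail bound, and a union bound joins them.

Importance sampling (`measure_snis_deviation_le`). With `q = ∫ f dQ`, the error of the estimate is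
`∑ w (f - q)` divided by `∑ w`. Since `Q` is `P` reweighted by `w`, the function `w (f - q)` has
mean exactly zero under `P`. Hence no bias has to be estimated, and the term `12 B (χ² + 1) / N₂`
enters only through being nonnegative. The function is bounded and `3Bβ`-Lipschitz, hence
sub-Gaussian under the strongly log-concave prior. This follows Maurey's argument: the
Prékopa–Leindler inequality bounds the product of the exponential moments of `φ` and `-φ` by `exp
(L² / γ)`, and Jensen's inequality removes the second factor when `φ` is centred. Hoeffding's
inequality keeps the total weight above half its mean, and a sup-norm cover of `F` makes the
estimate uniform.

Empirical mean (`measure_uniform_deviation_le`). This is the classical uniform law of large numbers: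
a ghost sample, random signs, and a union bound over an empirical `l₁` cover with Hoeffding's
inequality for Rademacher sums. Pointwise measurability reduces the class to a countable one. Covers
of `F` and `G` compose to a cover of `F ∘ G` because `F` is uniformly Lipschitz.

For (b) the thresholds are proportional to the two summands of `statError`, so that the exponents
dominate the logarithms of the covering numbers (`exists_tail_parameters`). A cover of `F` by one
ball needs care, because the first summand then vanishes; it can occur only for `ε` bounded below,
where large sample sizes suffice. The claim on minimizers applies the uniform deviation bound twice.
-/

namespace ATPF

open scoped Pointwise

/-! ### The Prékopa–Leindler inequality -/

/-- One-dimensional Brunn–Minkowski inequality for compact sets. -/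
lemma volume_add_le_of_isCompact {A B : Set ℝ} (hA : IsCompact A) (hB : IsCompact B)
    (hA' : A.Nonempty) (hB' : B.Nonempty) : volume A + volume B ≤ volume (A + B) := by
  -- The translates `A + min B` and `max A + B` both lie in `A + B` and meet at most in the point
  -- `max A + min B`.
  obtain ⟨a, ha, hamax⟩ := hA.exists_isGreatest hA'
  obtain ⟨b, hb, hbmin⟩ := hB.exists_isLeast hB'
  have h1 : volume ((fun x => x + b) '' A) = volume A := by simp
  have h2 : volume ((fun x => a + x) '' B) = volume B := by simp
  rw [← h1, ← h2, ← measure_union₀]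
  · refine measure_mono ?_
    rintro _ (⟨x, hx, rfl⟩ | ⟨x, hx, rfl⟩)
    · exact Set.add_mem_add hx hb
    · exact Set.add_mem_add ha hx
  · exact (hB.image (by fun_prop)).measurableSet.nullMeasurableSet
  · refine measure_mono_null (t := {a + b}) ?_ (by simp)
    rintro _ ⟨⟨x, hx, rfl⟩, ⟨z, hz, hxz⟩⟩
    have := hamax hx
    have := hbmin hz
    simp only [Set.mem_singleton_iff] at *
    linarith

/-- One-dimensional Brunn–Minkowski inequality. -/
lemma volume_add_le {A B : Set ℝ} (hA : MeasurableSet A) (hB : MeasurableSet B)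
    (hA' : A.Nonempty) (hB' : B.Nonempty) : volume A + volume B ≤ volume (A + B) := by
  obtain ⟨a, ha⟩ := hA'
  obtain ⟨b, hb⟩ := hB'
  rw [hA.measure_eq_iSup_isCompact, hB.measure_eq_iSup_isCompact]
  simp only [iSup_and']
  refine ENNReal.biSup_add_biSup_le' ⟨∅, by simp⟩ ⟨∅, by simp⟩ ?_
  rintro K ⟨hKA, hK⟩ L ⟨hLB, hL⟩
  -- The approximating compact sets may be empty; adjoining the points `a` and `b` makes the compact
  -- case applicable.
  calc volume K + volume L ≤ volume (insert a K) + volume (insert b L) := by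
        gcongr <;> exact Set.subset_insert _ _
    _ ≤ volume (insert a K + insert b L) :=
        volume_add_le_of_isCompact (hK.insert a) (hL.insert b) (by simp) (by simp)
    _ ≤ volume (A + B) := by
        gcongr
        · exact Set.insert_subset ha hKA
        · exact Set.insert_subset hb hLB

/-- Layer-cake argument: for `0 < t < 1` the superlevel sets of `f` and `g` are nonempty and their
sum lies in that of `H`, so one-dimensional Brunn–Minkowski applies level by level. For `t ≥ 1` the
sets of `f` and `g` are empty. The common supremum 1 is what makes the levels match. -/
lemma lintegral_add_le_of_mul_le_sq {f g H : ℝ → ℝ} (hf : Measurable f) (hg : Measurable g)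
    (hH : Measurable H) (hf0 : ∀ x, 0 ≤ f x) (hg0 : ∀ x, 0 ≤ g x) (hH0 : ∀ x, 0 ≤ H x)
    (hf1 : ∀ x, f x ≤ 1) (hg1 : ∀ x, g x ≤ 1) (hfs : ∀ t < 1, ∃ x, t < f x)
    (hgs : ∀ t < 1, ∃ x, t < g x) (h : ∀ x y, f x * g y ≤ H (x + y) ^ 2) :
    (∫⁻ x, ENNReal.ofReal (f x)) + ∫⁻ x, ENNReal.ofReal (g x) ≤ ∫⁻ x, ENNReal.ofReal (H x) := by
  rw [lintegral_eq_lintegral_meas_lt _ (ae_of_all _ hf0) hf.aemeasurable,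
    lintegral_eq_lintegral_meas_lt _ (ae_of_all _ hg0) hg.aemeasurable,
    lintegral_eq_lintegral_meas_lt _ (ae_of_all _ hH0) hH.aemeasurable, ← lintegral_add_left']
  · refine setLIntegral_mono' measurableSet_Ioi fun t ht => ?_
    rcases lt_or_ge t 1 with ht1 | ht1
    · refine (volume_add_le (measurableSet_lt measurable_const hf)
        (measurableSet_lt measurable_const hg) (hfs t ht1) (hgs t ht1)).trans (measure_mono ?_)
      rintro _ ⟨x, hx, z, hz, rfl⟩
      simp only [Set.mem_ofPred_eq] at hx hz ⊢
      refine lt_of_pow_lt_pow_left₀ 2 (hH0 _) (lt_of_lt_of_le ?_ (h x z))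
      have ht0 : (0:ℝ) < t := ht
      nlinarith
    · have e1 : {a | t < f a} = ∅ := by
        ext a; simpa using (hf1 a).trans ht1
      have e2 : {a | t < g a} = ∅ := by
        ext a; simpa using (hg1 a).trans ht1
      simp [e1, e2]
  · refine Measurable.aemeasurable ?_
    exact (Antitone.measurable fun s t hst => measure_mono fun x hx => lt_of_le_of_lt hst hx)

/-- The arithmetic–geometric mean inequality; it turns the additive inequality for functions
normalised by their suprema `a` and `b` into the multiplicative one. -/
lemma four_mul_le_sq_of_div_add_div_le {a b u v w : ℝ} (ha : 0 < a) (hb : 0 < b) (hu : 0 ≤ u)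
    (hv : 0 ≤ v) (h : u / a + v / b ≤ w / √(a * b)) : 4 * (u * v) ≤ w ^ 2 := by
  have hab : 0 < a * b := by positivity
  have hs : 0 < √(a * b) := Real.sqrt_pos.2 hab
  have h1 : (u / a + v / b) * √(a * b) ≤ w := (le_div_iff₀ hs).1 h
  calc 4 * (u * v) ≤ (u / a + v / b) ^ 2 * (a * b) := by
        have : (u / a + v / b) ^ 2 * (a * b) - 4 * (u * v) = (u / a - v / b) ^ 2 * (a * b) := by
          field_simp; ring
        nlinarith [mul_nonneg (sq_nonneg (u / a - v / b)) hab.le]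
    _ = ((u / a + v / b) * √(a * b)) ^ 2 := by rw [mul_pow, Real.sq_sqrt hab.le]
    _ ≤ w ^ 2 := by gcongr

/-- Dividing `f`, `g` by their suprema and `H` by the geometric mean of these preserves the
hypothesis and reduces to the case of supremum 1. Boundedness makes the suprema finite. -/
lemma prekopaLeindler_real_of_le {f g H : ℝ → ℝ≥0∞} (hf : Measurable f) (hg : Measurable g)
    (hH : Measurable H) {n : ℕ} (hfn : ∀ x, f x ≤ n) (hgn : ∀ x, g x ≤ n)
    (h : ∀ x y, f x * g y ≤ H (x + y) ^ 2) :
    4 * ((∫⁻ x, f x) * ∫⁻ x, g x) ≤ (∫⁻ x, H x) ^ 2 := by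
  by_cases hf0 : ∫⁻ x, f x = 0
  · simp [hf0]
  by_cases hg0 : ∫⁻ x, g x = 0
  · simp [hg0]
  by_cases hHt : ∫⁻ x, H x = ∞
  · simp [hHt]
  have hff : ∀ x, f x ≠ ∞ := fun x => ne_top_of_le_ne_top (by simp) (hfn x)
  have hgf : ∀ x, g x ≠ ∞ := fun x => ne_top_of_le_ne_top (by simp) (hgn x)
  have hsup : ∀ k : ℝ → ℝ≥0∞, (∀ x, k x ≤ n) → ∫⁻ x, k x ≠ 0 →
      0 < (⨆ x, k x) ∧ (⨆ x, k x) ≠ ∞ := by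
    intro k hk hk0
    refine ⟨pos_iff_ne_zero.2 fun h0 => hk0 ?_, ne_top_of_le_ne_top (by simp) (iSup_le hk)⟩
    have : ∀ x, k x = 0 := by simpa using h0
    simp [this]
  obtain ⟨ha0, hat⟩ := hsup f hfn hf0
  obtain ⟨hb0, hbt⟩ := hsup g hgn hg0
  set a := ⨆ x, f x with ha
  set b := ⨆ x, g x with hb
  have ha' : 0 < a.toReal := ENNReal.toReal_pos ha0.ne' hat
  have hb' : 0 < b.toReal := ENNReal.toReal_pos hb0.ne' hbt
  set s := √(a.toReal * b.toReal) with hs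
  have hs0 : 0 < s := Real.sqrt_pos.2 (by positivity)
  -- Truncation at `n` keeps the hypothesis, since `f x * g y ≤ n ^ 2`, and makes `H` real-valued.
  set K : ℝ → ℝ≥0∞ := fun x => min (H x) n with hK
  have hKt : ∀ x, K x ≠ ∞ := fun x => ne_top_of_le_ne_top (by simp) (min_le_right _ _)
  have hKm : Measurable K := hH.min measurable_const
  have hKH : ∫⁻ x, K x ≤ ∫⁻ x, H x := lintegral_mono fun x => min_le_left _ _
  have hfgK : ∀ x y, f x * g y ≤ K (x + y) ^ 2 := by
    intro x y
    rcases min_choice (H (x + y)) (n : ℝ≥0∞) with h' | h'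
    · simp only [hK, h']; exact h x y
    · simp only [hK, h', sq]; exact mul_le_mul' (hfn x) (hgn y)
  have hscale : ∀ (k : ℝ → ℝ≥0∞) (c : ℝ), Measurable k → 0 < c → (∀ x, k x ≠ ∞) →
      ∫⁻ x, ENNReal.ofReal ((k x).toReal / c) = (∫⁻ x, k x) * (ENNReal.ofReal c)⁻¹ := by
    intro k c hkm hc hk
    rw [← lintegral_mul_const _ hkm]
    refine lintegral_congr fun x => ?_
    rw [ENNReal.ofReal_div_of_pos hc, ENNReal.ofReal_toReal (hk x), div_eq_mul_inv]
  have hex : ∀ k : ℝ → ℝ≥0∞, (∀ x, k x ≠ ∞) → 0 < (⨆ x, k x).toReal → ∀ t < (1:ℝ),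
      ∃ x, t < (k x).toReal / (⨆ x, k x).toReal := by
    intro k hk h0 t ht
    by_contra! hcon
    have h1 : (⨆ x, k x) ≤ ENNReal.ofReal (t * (⨆ x, k x).toReal) := by
      refine iSup_le fun x => ?_
      rw [← ENNReal.ofReal_toReal (hk x)]
      exact ENNReal.ofReal_le_ofReal ((div_le_iff₀ h0).1 (hcon x))
    have h2 := ENNReal.toReal_mono (by finiteness) h1
    rw [ENNReal.toReal_ofReal'] at h2
    rcases le_max_iff.1 h2 with h2 | h2 <;> nlinarith
  have key := lintegral_add_le_of_mul_le_sq (f := fun x => (f x).toReal / a.toReal)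
    (g := fun x => (g x).toReal / b.toReal) (H := fun x => (K x).toReal / s)
    (hf.ennreal_toReal.div_const _) (hg.ennreal_toReal.div_const _)
    (hKm.ennreal_toReal.div_const _) (fun x => by positivity) (fun x => by positivity)
    (fun x => by positivity)
    (fun x => (div_le_one ha').2 (ENNReal.toReal_mono hat (le_iSup f x)))
    (fun x => (div_le_one hb').2 (ENNReal.toReal_mono hbt (le_iSup g x)))
    (fun t ht => ?_) (fun t ht => ?_) (fun x y => ?_)
  · rw [hscale f _ hf ha' hff, hscale g _ hg hb' hgf, hscale K _ hKm hs0 hKt] at key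
    have hKfin : ∫⁻ x, K x ≠ ∞ := ne_top_of_le_ne_top hHt hKH
    have hinv : ∀ c : ℝ, 0 < c → (ENNReal.ofReal c)⁻¹ ≠ 0 ∧ (ENNReal.ofReal c)⁻¹ ≠ ∞ :=
      fun c hc => ⟨by simp, by simpa using hc⟩
    have hR : (∫⁻ x, K x) * (ENNReal.ofReal s)⁻¹ ≠ ∞ := ENNReal.mul_ne_top hKfin (hinv s hs0).2
    -- Finiteness of the integrals of `f` and `g` is read off from the additive inequality itself,
    -- whose right side is finite.
    have hfin : ∀ (u : ℝ≥0∞) (c : ℝ), 0 < c → u * (ENNReal.ofReal c)⁻¹ ≠ ∞ → u ≠ ∞ := by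
      rintro u c hc hu rfl
      exact hu (ENNReal.top_mul (hinv c hc).1)
    have hu := hfin _ _ ha' (ne_top_of_le_ne_top hR (le_self_add.trans key))
    have hv := hfin _ _ hb' (ne_top_of_le_ne_top hR (le_add_self.trans key))
    have key' := ENNReal.toReal_mono hR key
    rw [ENNReal.toReal_add (ENNReal.mul_ne_top hu (hinv _ ha').2)
      (ENNReal.mul_ne_top hv (hinv _ hb').2)] at key'
    simp only [ENNReal.toReal_mul, ENNReal.toReal_inv, ENNReal.toReal_ofReal ha'.le,
      ENNReal.toReal_ofReal hb'.le, ENNReal.toReal_ofReal hs0.le] at key'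
    simp only [← div_eq_mul_inv] at key'
    have := four_mul_le_sq_of_div_add_div_le ha' hb' ENNReal.toReal_nonneg
      ENNReal.toReal_nonneg key'
    calc 4 * ((∫⁻ x, f x) * ∫⁻ x, g x) ≤ (∫⁻ x, K x) ^ 2 := by
          rw [← ENNReal.toReal_le_toReal (by finiteness) (by finiteness)]
          simpa using this
      _ ≤ _ := by gcongr
  · exact hex f hff ha' t ht
  · exact hex g hgf hb' t ht
  · have := ENNReal.toReal_mono (by finiteness [hKt (x+y)]) (hfgK x y)
    rw [div_mul_div_comm, div_pow, hs, Real.sq_sqrt (by positivity)]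
    gcongr
    simpa using this

/-- One-dimensional Prékopa–Leindler inequality, at the midpoint. -/
lemma prekopaLeindler_real {f g H : ℝ → ℝ≥0∞} (hf : Measurable f) (hg : Measurable g)
    (hH : Measurable H) (h : ∀ x y, f x * g y ≤ H (x + y) ^ 2) :
    4 * ((∫⁻ x, f x) * ∫⁻ x, g x) ≤ (∫⁻ x, H x) ^ 2 := by
  have hmono : ∀ k : ℝ → ℝ≥0∞, Monotone fun (n : ℕ) x => min (k x) (n : ℝ≥0∞) :=
    fun k n m hnm x => min_le_min_left _ (by exact_mod_cast hnm)
  have hlim : ∀ k : ℝ → ℝ≥0∞, Measurable k →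
      ∫⁻ x, k x = ⨆ n : ℕ, ∫⁻ x, min (k x) (n : ℝ≥0∞) := by
    intro k hk
    rw [← lintegral_iSup (fun n => hk.min measurable_const) (hmono k)]
    refine lintegral_congr fun x => ?_
    rw [← inf_iSup_eq, ENNReal.iSup_natCast, inf_top_eq]
  rw [hlim f hf, hlim g hg, ENNReal.iSup_mul, ENNReal.mul_iSup]
  refine iSup_le fun n => ?_
  rw [ENNReal.mul_iSup, ENNReal.mul_iSup]
  refine iSup_le fun m => ?_
  calc 4 * ((∫⁻ x, min (f x) n) * ∫⁻ x, min (g x) m)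
      ≤ 4 * ((∫⁻ x, min (f x) (max n m : ℕ)) * ∫⁻ x, min (g x) (max n m : ℕ)) := by
        gcongr with x x
        · exact le_max_left n m
        · exact le_max_right n m
    _ ≤ _ := prekopaLeindler_real_of_le (n := max n m) (hf.min measurable_const)
        (hg.min measurable_const) hH (fun x => min_le_right _ _) (fun x => min_le_right _ _)
        fun x y => (mul_le_mul' (min_le_left _ _) (min_le_left _ _)).trans (h x y)

/-- Prékopa–Leindler inequality on `ℝⁿ`, at the midpoint. -/
lemma prekopaLeindler_pi : ∀ {n : ℕ} {f g H : (Fin n → ℝ) → ℝ≥0∞}, Measurable f → Measurable g →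
    Measurable H → (∀ x y, f x * g y ≤ H (x + y) ^ 2) →
    4 ^ n * ((∫⁻ x, f x) * ∫⁻ x, g x) ≤ (∫⁻ x, H x) ^ 2
  | 0, f, g, H, hf, hg, hH, h => by
    rw [volume_pi, Measure.pi_of_empty _ (0 : Fin 0 → ℝ), lintegral_dirac' _ hf, lintegral_dirac' _ hg, lintegral_dirac' _ hH,
      pow_zero, one_mul]
    exact (h 0 0).trans_eq (by rw [add_zero])
  | n + 1, f, g, H, hf, hg, hH, h => by
    have e := (volume_preserving_piFinSuccAbove (fun _ : Fin (n + 1) => ℝ) 0).symm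
    have hint : ∀ k : (Fin (n + 1) → ℝ) → ℝ≥0∞, Measurable k →
        ∫⁻ x, k x = ∫⁻ s : ℝ, ∫⁻ v : Fin n → ℝ, k (Fin.insertNth 0 s v) := by
      intro k hk
      rw [← e.lintegral_comp hk]
      exact lintegral_prod _ (hk.comp e.measurable).aemeasurable
    have hmeas : ∀ k : (Fin (n + 1) → ℝ) → ℝ≥0∞, Measurable k →
        Measurable fun p : ℝ × (Fin n → ℝ) => k (Fin.insertNth 0 p.1 p.2) :=
      fun k hk => hk.comp e.measurable
    have hadd : ∀ (s t : ℝ) (v w : Fin n → ℝ),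
        (Fin.insertNth 0 s v : Fin (n + 1) → ℝ) + Fin.insertNth 0 t w
          = Fin.insertNth 0 (s + t) (v + w) := by
      intro s t v w
      ext i
      refine Fin.cases ?_ (fun i => ?_) i <;> simp
    rw [hint f hf, hint g hg, hint H hH]
    -- Induction on the dimension: the slice integrals satisfy the one-dimensional hypothesis by the
    -- inequality in dimension `n`. The factors `2 ^ n` absorb its constant `4 ^ n`.
    have key := prekopaLeindler_real
      (f := fun s => 2 ^ n * ∫⁻ v : Fin n → ℝ, f (Fin.insertNth 0 s v))
      (g := fun s => 2 ^ n * ∫⁻ v : Fin n → ℝ, g (Fin.insertNth 0 s v))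
      (H := fun s => ∫⁻ v : Fin n → ℝ, H (Fin.insertNth 0 s v))
      ((hmeas f hf).lintegral_prod_right'.const_mul _)
      ((hmeas g hg).lintegral_prod_right'.const_mul _) (hmeas H hH).lintegral_prod_right'
      fun s t => by
        rw [mul_mul_mul_comm, ← mul_pow, show (2 * 2 : ℝ≥0∞) = 4 by norm_num]
        refine prekopaLeindler_pi ((hmeas f hf).comp measurable_prodMk_left)
          ((hmeas g hg).comp measurable_prodMk_left) ((hmeas H hH).comp measurable_prodMk_left)
          fun v w => ?_
        simpa [hadd] using h (Fin.insertNth 0 s v) (Fin.insertNth 0 t w)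
    rw [lintegral_const_mul _ (hmeas f hf).lintegral_prod_right',
      lintegral_const_mul _ (hmeas g hg).lintegral_prod_right', mul_mul_mul_comm, ← mul_pow,
      show (2 * 2 : ℝ≥0∞) = 4 by norm_num, ← mul_assoc, ← pow_succ'] at key
    exact key

/-- Prékopa–Leindler inequality on `EuclideanSpace ℝ (Fin d)`, at the midpoint. -/
lemma prekopaLeindler_euc {d : ℕ} {f g H : Euc d → ℝ≥0∞} (hf : Measurable f) (hg : Measurable g)
    (hH : Measurable H) (h : ∀ x y, f x * g y ≤ H (x + y) ^ 2) :
    4 ^ d * ((∫⁻ x, f x) * ∫⁻ x, g x) ≤ (∫⁻ x, H x) ^ 2 := by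
  have e' := PiLp.volume_preserving_toLp (Fin d)
  rw [← e'.lintegral_comp hf, ← e'.lintegral_comp hg, ← e'.lintegral_comp hH]
  exact prekopaLeindler_pi (hf.comp e'.measurable) (hg.comp e'.measurable) (hH.comp e'.measurable)
    fun x y => by simpa using h (WithLp.toLp 2 x) (WithLp.toLp 2 y)

/-! ### Concentration for strongly log-concave measures -/

/-- A strongly log-concave measure has a measurable density `exp (-ψ)` on a convex open set. -/
lemma IsStronglyLogConcave.exists_density {d : ℕ} {P : Measure (Euc d)} {γ : ℝ} (hγ : 0 ≤ γ)
    (h : IsStronglyLogConcave P γ) : ∃ (U : Set (Euc d)) (ψ : Euc d → ℝ), StrongConvexOn U γ ψ ∧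
      Measurable (U.indicator fun x => ENNReal.ofReal (Real.exp (-ψ x))) ∧
      P = volume.withDensity (U.indicator fun x => ENNReal.ofReal (Real.exp (-ψ x))) := by
  obtain ⟨K, ψ, hψ, rfl⟩ := h
  have hK : Convex ℝ K := hψ.1
  have hconv : ConvexOn ℝ K ψ := hψ.convexOn fun r => by positivity
  -- On the interior the convex function `ψ` is continuous, so the density is measurable; the
  -- discarded boundary of a convex set is Lebesgue null.
  refine ⟨interior K, ψ, ⟨hK.interior, fun x hx y hy => hψ.2 (interior_subset hx)
    (interior_subset hy)⟩, ?_, ?_⟩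
  · classical
    rw [← Set.piecewise_eq_indicator]
    refine ContinuousOn.measurable_piecewise ?_ continuousOn_const isOpen_interior.measurableSet
    exact ENNReal.continuous_ofReal.comp_continuousOn
      (Real.continuous_exp.comp_continuousOn hconv.continuousOn_interior.neg)
  · rw [withDensity_indicator isOpen_interior.measurableSet,
      Measure.restrict_congr_set (interior_ae_eq_of_null_frontier (hK.addHaar_frontier volume))]

/-- The product of the exponential moments of a Lipschitz function and of its negative, for a
strongly log-concave probability measure. -/
lemma IsStronglyLogConcave.lintegral_exp_mul_lintegral_exp_neg_le {d : ℕ} {P : Measure (Euc d)}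
    [IsProbabilityMeasure P] {γ : ℝ} (hγ : 0 < γ) (h : IsStronglyLogConcave P γ)
    {φ : Euc d → ℝ} (hφ : Measurable φ) {L : ℝ} (hL : ∀ x y, |φ x - φ y| ≤ L * ‖x - y‖) :
    (∫⁻ x, ENNReal.ofReal (Real.exp (φ x)) ∂P) * (∫⁻ x, ENNReal.ofReal (Real.exp (-φ x)) ∂P) ≤
      ENNReal.ofReal (Real.exp (L ^ 2 / γ)) := by
  obtain ⟨U, ψ, hψ, hm, rfl⟩ := h.exists_density hγ.le
  set ρ := U.indicator fun x => ENNReal.ofReal (Real.exp (-ψ x)) with hρ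
  have hρ1 : ∫⁻ x, ρ x = 1 := by
    have := measure_univ (μ := volume.withDensity ρ)
    rwa [withDensity_apply _ MeasurableSet.univ, Measure.restrict_univ] at this
  have hscale : ∫⁻ x, ρ ((2:ℝ)⁻¹ • x) = 2 ^ d := by
    have := lintegral_map (μ := volume) hm (measurable_const_smul (2:ℝ)⁻¹ (α := Euc d))
    rw [← this, Measure.map_addHaar_smul _ (by norm_num), lintegral_smul_measure, hρ1]
    simp [ENNReal.ofReal_pow]
  have hm1 : Measurable fun x => ENNReal.ofReal (Real.exp (φ x)) := by fun_prop
  have hm2 : Measurable fun x => ENNReal.ofReal (Real.exp (-φ x)) := by fun_prop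
  rw [lintegral_withDensity_eq_lintegral_mul _ hm hm1,
    lintegral_withDensity_eq_lintegral_mul _ hm hm2]
  set C : ℝ≥0∞ := ENNReal.ofReal (Real.exp (L ^ 2 / γ / 2)) with hC
  have hCC : C ^ 2 = ENNReal.ofReal (Real.exp (L ^ 2 / γ)) := by
    rw [hC, ← ENNReal.ofReal_pow (by positivity), ← Real.exp_nat_mul]
    congr 2; push_cast; ring
  -- `H` is evaluated at a sum, so the midpoint density appears rescaled by 1/2. Its integral `2 ^
  -- d`, squared, cancels the constant `4 ^ d`.
  have key := prekopaLeindler_euc (hm.mul hm1) (hm.mul hm2)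
    (H := fun z => C * ρ ((2:ℝ)⁻¹ • z)) (by fun_prop) fun x y => ?_
  · rw [lintegral_const_mul _ (by fun_prop), hscale, mul_pow, hCC, ← pow_mul, mul_comm d 2,
      pow_mul, mul_comm (ENNReal.ofReal _), show (2 ^ 2 : ℝ≥0∞) = 4 by norm_num] at key
    exact (ENNReal.mul_le_mul_iff_right (by simp) (by finiteness)).1 key
  · simp only [Pi.mul_apply]
    by_cases hx : x ∈ U
    swap
    · simp [hρ, hx]
    by_cases hy : y ∈ U
    swap
    · simp [hρ, hy]
    have hmid : (2:ℝ)⁻¹ • (x + y) = (2:ℝ)⁻¹ • x + (2:ℝ)⁻¹ • y := smul_add _ _ _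
    have hz : (2:ℝ)⁻¹ • (x + y) ∈ U := by
      rw [hmid]; exact hψ.1 hx hy (by norm_num) (by norm_num) (by norm_num)
    have hcv := hψ.2 hx hy (show (0:ℝ) ≤ 2⁻¹ by norm_num) (show (0:ℝ) ≤ 2⁻¹ by norm_num) (by norm_num)
    rw [← hmid] at hcv
    simp only [smul_eq_mul] at hcv
    simp only [hρ, Set.indicator_of_mem hx, Set.indicator_of_mem hy, Set.indicator_of_mem hz, hC]
    simp only [← ENNReal.ofReal_mul (Real.exp_nonneg _), ← Real.exp_add]
    rw [← ENNReal.ofReal_pow (by positivity), ← Real.exp_nat_mul]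
    refine ENNReal.ofReal_le_ofReal (Real.exp_le_exp.2 ?_)
    have h1 := (abs_le.1 (hL x y)).2
    -- Young's inequality; the quadratic term equals twice the midpoint gain `γ / 8 * ‖x - y‖ ^ 2`
    -- of strong convexity.
    have h2 : L * ‖x - y‖ ≤ L ^ 2 / γ + γ / 4 * ‖x - y‖ ^ 2 := by
      have : L ^ 2 / γ + γ / 4 * ‖x - y‖ ^ 2 - L * ‖x - y‖ = γ * (L / γ - ‖x - y‖ / 2) ^ 2 := by
        field_simp; ring
      nlinarith [mul_nonneg hγ.le (sq_nonneg (L / γ - ‖x - y‖ / 2))]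
    push_cast
    linarith

/-- Bounded centred Lipschitz functions are sub-Gaussian under a strongly log-concave measure. -/
lemma IsStronglyLogConcave.hasSubgaussianMGF {d : ℕ} {P : Measure (Euc d)}
    [IsProbabilityMeasure P] {γ : ℝ} (hγ : 0 < γ) (h : IsStronglyLogConcave P γ)
    {φ : Euc d → ℝ} (hφ : Measurable φ) {L M : ℝ} (hL : ∀ x y, |φ x - φ y| ≤ L * ‖x - y‖)
    (hM : ∀ x, |φ x| ≤ M) (h0 : ∫ x, φ x ∂P = 0) :
    HasSubgaussianMGF φ (2 * L ^ 2 / γ).toNNReal P := by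
  have hint : ∀ t : ℝ, Integrable (fun x => Real.exp (t * φ x)) P := fun t => by
    refine Integrable.of_bound (by fun_prop) (Real.exp (|t| * M)) (ae_of_all _ fun x => ?_)
    rw [Real.norm_of_nonneg (Real.exp_nonneg _)]
    refine Real.exp_le_exp.2 ((le_abs_self _).trans ?_)
    rw [abs_mul]
    exact mul_le_mul_of_nonneg_left (hM x) (abs_nonneg t)
  have hφi : Integrable φ P := Integrable.of_bound hφ.aestronglyMeasurable M (ae_of_all _ hM)
  refine ⟨hint, fun t => ?_⟩
  have key := h.lintegral_exp_mul_lintegral_exp_neg_le hγ (hφ.const_mul t) (L := |t| * L)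
    fun x y => by
      rw [← mul_sub, abs_mul, mul_assoc]
      exact mul_le_mul_of_nonneg_left (hL x y) (abs_nonneg t)
  -- Jensen's inequality for the centred function, through `1 + u ≤ exp u`; the second factor of the
  -- product bound can then be dropped.
  have hge : 1 ≤ ∫⁻ x, ENNReal.ofReal (Real.exp (-(t * φ x))) ∂P := by
    have hi : Integrable (fun x => Real.exp (-(t * φ x))) P := by
      simpa [neg_mul] using hint (-t)
    rw [← ofReal_integral_eq_lintegral_ofReal hi (ae_of_all _ fun x => Real.exp_nonneg _),
      ← ENNReal.ofReal_one]
    refine ENNReal.ofReal_le_ofReal ?_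
    calc (1:ℝ) = ∫ x, (1 + -(t * φ x)) ∂P := by
          have := integral_add (integrable_const (1:ℝ)) (hφi.const_mul t).neg
          simp only [Pi.neg_apply] at this
          rw [this, integral_neg, integral_const_mul, h0]
          simp
      _ ≤ _ := integral_mono ((integrable_const _).add (hφi.const_mul t).neg) hi fun x => by
          have := Real.add_one_le_exp (-(t * φ x))
          simp only
          linarith
  have h1 : ENNReal.ofReal (mgf φ P t) ≤ ENNReal.ofReal (Real.exp ((|t| * L) ^ 2 / γ)) := by
    rw [mgf, ofReal_integral_eq_lintegral_ofReal (hint t) (ae_of_all _ fun x => Real.exp_nonneg _)]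
    exact (le_mul_of_one_le_right' hge).trans key
  refine ((ENNReal.ofReal_le_ofReal_iff (Real.exp_nonneg _)).1 h1).trans_eq ?_
  rw [Real.coe_toNNReal _ (by positivity), mul_pow, sq_abs]
  congr 1
  ring

/-- Tail bound for the sum of a sub-Gaussian function over an i.i.d. sample. -/
lemma IsIIDSample.measure_sum_ge_le {Ω E : Type*} [MeasurableSpace Ω] [MeasurableSpace E]
    {μ : Measure Ω} [IsProbabilityMeasure μ] {n : ℕ} {X : Fin n → Ω → E} {P : Measure E}
    (hX : IsIIDSample μ X P) {φ : E → ℝ} (hφ : Measurable φ) {c : ℝ≥0}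
    (h : HasSubgaussianMGF φ c P) {s : ℝ} (hs : 0 ≤ s) :
    μ {ω | s ≤ ∑ i, φ (X i ω)} ≤ ENNReal.ofReal (Real.exp (-s ^ 2 / (2 * (n * c)))) := by
  have hind : iIndepFun (fun i ω => φ (X i ω)) μ := hX.indep.comp (fun _ => φ) fun _ => hφ
  have := HasSubgaussianMGF.measure_sum_ge_le_of_iIndepFun hind (c := fun _ => c)
    (s := Finset.univ) (fun i _ => HasSubgaussianMGF.of_map (hX.measurable i).aemeasurable
      (by rw [hX.law i]; exact h)) hs
  rw [← ofReal_measureReal]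
  refine ENNReal.ofReal_le_ofReal (this.trans_eq ?_)
  simp

/-- Two-sided tail bound for the sum of a sub-Gaussian function over an i.i.d. sample. -/
lemma IsIIDSample.measure_abs_sum_ge_le {Ω E : Type*} [MeasurableSpace Ω] [MeasurableSpace E]
    {μ : Measure Ω} [IsProbabilityMeasure μ] {n : ℕ} {X : Fin n → Ω → E} {P : Measure E}
    (hX : IsIIDSample μ X P) {φ : E → ℝ} (hφ : Measurable φ) {c : ℝ≥0}
    (h : HasSubgaussianMGF φ c P) {s : ℝ} (hs : 0 ≤ s) :
    μ {ω | s ≤ |∑ i, φ (X i ω)|} ≤ 2 * ENNReal.ofReal (Real.exp (-s ^ 2 / (2 * (n * c)))) := by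
  have h1 := hX.measure_sum_ge_le hφ h hs
  have h2 := hX.measure_sum_ge_le hφ.neg h.neg hs
  rw [two_mul]
  refine le_trans (measure_mono ?_) ((measure_union_le _ _).trans (add_le_add h1 h2))
  intro ω hω
  simp only [Set.mem_ofPred_eq, Set.mem_union, Pi.neg_apply, Finset.sum_neg_distrib] at hω ⊢
  exact le_abs.1 hω

/-! ### Covering numbers -/

/-- A pseudo-metric covering number is attained by a finite family of members of the class. -/
lemma exists_finset_of_coveringNumber_image_ne_top {ι Y : Type*} [PseudoEMetricSpace Y] {r : ℝ≥0}
    {F : Set ι} {e : ι → Y} (h : Metric.coveringNumber r (e '' F) ≠ ⊤) :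
    ∃ C : Finset ι, ↑C ⊆ F ∧ (C.card : ℕ∞) ≤ Metric.coveringNumber r (e '' F) ∧
      ∀ f ∈ F, ∃ g ∈ C, edist (e f) (e g) ≤ r := by
  classical
  rcases isEmpty_or_nonempty ι with hι | hι
  · exact ⟨∅, by simp, by simp, fun f => isEmptyElim f⟩
  obtain ⟨C, hCF, hfin, hcov, hcard⟩ := Metric.exists_set_encard_eq_coveringNumber h
  choose! u hu hue using fun c (hc : c ∈ C) => hCF hc
  refine ⟨hfin.toFinset.image u, ?_, ?_, ?_⟩
  · intro f hf
    simp only [Finset.coe_image, Set.Finite.coe_toFinset, Set.mem_image] at hf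
    obtain ⟨c, hc, rfl⟩ := hf
    exact hu c hc
  · rw [← hcard, hfin.encard_eq_coe_toFinset_card]
    exact_mod_cast Finset.card_image_le
  · intro f hf
    obtain ⟨c, hc, hfc⟩ := hcov (Set.mem_image_of_mem e hf)
    exact ⟨u c, by simpa using ⟨c, hc, rfl⟩, by rw [hue c hc]; exact hfc⟩

lemma coveringNumber_image_le_card {ι Y : Type*} [PseudoEMetricSpace Y] {r : ℝ≥0}
    {F : Set ι} {e : ι → Y} {C : Finset ι} (hC : ↑C ⊆ F)
    (h : ∀ f ∈ F, ∃ g ∈ C, edist (e f) (e g) ≤ r) :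
    Metric.coveringNumber r (e '' F) ≤ C.card := by
  classical
  refine (Metric.IsCover.coveringNumber_le_encard (C := e '' C) (Set.image_mono hC) ?_).trans ?_
  · rintro _ ⟨f, hf, rfl⟩
    obtain ⟨g, hg, hfg⟩ := h f hf
    exact ⟨e g, Set.mem_image_of_mem e hg, hfg⟩
  · exact (Set.encard_image_le e _).trans_eq (Set.encard_coe_eq_coe_finsetCard C)

lemma exists_finset_supCover {E : Type*} {r : ℝ} (hr : 0 ≤ r) {F : Set (E → ℝ)}
    (h : supCover r F ≠ ∞) : ∃ C : Finset (E → ℝ), ↑C ⊆ F ∧ (C.card : ℝ≥0∞) ≤ supCover r F ∧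
      ∀ f ∈ F, ∃ g ∈ C, ∀ x, |f x - g x| ≤ r := by
  obtain ⟨C, hC, hcard, hcov⟩ := exists_finset_of_coveringNumber_image_ne_top
    (r := r.toNNReal) (F := F) (e := UniformFun.ofFun) (by simpa [supCover] using h)
  refine ⟨C, hC, by rw [supCover]; exact_mod_cast hcard, fun f hf => ?_⟩
  obtain ⟨g, hg, hfg⟩ := hcov f hf
  refine ⟨g, hg, fun x => ?_⟩
  have := UniformFun.edist_le.1 hfg x
  rw [edist_dist, ENNReal.ofReal_le_iff_le_toReal (by simp)] at this
  simpa [Real.dist_eq, hr] using this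

lemma edist_empirical_le_iff {E V : Type*} [NormedAddCommGroup V] [NormedSpace ℝ V] {n : ℕ}
    {r : ℝ} (hr : 0 ≤ r) (x : Fin n → E) (g h : E → V) :
    edist ((1 / (n : ℝ)) • WithLp.toLp 1 (fun i => g (x i)) : PiLp 1 fun _ : Fin n => V)
      ((1 / (n : ℝ)) • WithLp.toLp 1 (fun i => h (x i))) ≤ r.toNNReal ↔
      (1 / (n : ℝ)) * ∑ i, ‖g (x i) - h (x i)‖ ≤ r := by
  rw [edist_dist, ENNReal.ofReal_le_iff_le_toReal (by simp), dist_smul₀, PiLp.dist_eq_of_L1]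
  simp [dist_eq_norm, hr]

lemma exists_finset_empCover {E V : Type*} [NormedAddCommGroup V] [NormedSpace ℝ V] {n : ℕ}
    {r : ℝ} (hr : 0 ≤ r) {G : Set (E → V)} {x : Fin n → E} (h : empCover r G x ≠ ∞) :
    ∃ C : Finset (E → V), ↑C ⊆ G ∧ (C.card : ℝ≥0∞) ≤ empCover r G x ∧
      ∀ f ∈ G, ∃ g ∈ C, (1 / (n : ℝ)) * ∑ i, ‖f (x i) - g (x i)‖ ≤ r := by
  obtain ⟨C, hC, hcard, hcov⟩ := exists_finset_of_coveringNumber_image_ne_top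
    (r := r.toNNReal) (F := G)
    (e := fun g : E → V => ((1 / (n : ℝ)) • WithLp.toLp 1 (fun i => g (x i)) :
      PiLp 1 fun _ : Fin n => V)) (by simpa [empCover] using h)
  refine ⟨C, hC, by rw [empCover]; exact_mod_cast hcard, fun f hf => ?_⟩
  obtain ⟨g, hg, hfg⟩ := hcov f hf
  exact ⟨g, hg, (edist_empirical_le_iff hr x f g).1 hfg⟩

lemma empCover_le_card {E V : Type*} [NormedAddCommGroup V] [NormedSpace ℝ V] {n : ℕ}
    {r : ℝ} (hr : 0 ≤ r) {G : Set (E → V)} {x : Fin n → E} {C : Finset (E → V)} (hC : ↑C ⊆ G)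
    (h : ∀ f ∈ G, ∃ g ∈ C, (1 / (n : ℝ)) * ∑ i, ‖f (x i) - g (x i)‖ ≤ r) :
    empCover r G x ≤ C.card := by
  have := coveringNumber_image_le_card (r := r.toNNReal) (F := G)
    (e := fun g : E → V => ((1 / (n : ℝ)) • WithLp.toLp 1 (fun i => g (x i)) :
      PiLp 1 fun _ : Fin n => V)) hC fun f hf => by
        obtain ⟨g, hg, hfg⟩ := h f hf
        exact ⟨g, hg, (edist_empirical_le_iff hr x f g).2 hfg⟩
  rw [empCover]
  exact_mod_cast this

lemma one_le_supCover {E : Type*} {r : ℝ} {F : Set (E → ℝ)} (hF : F.Nonempty) :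
    1 ≤ supCover r F := by
  have : 1 ≤ Metric.coveringNumber r.toNNReal (UniformFun.ofFun '' F) :=
    Order.one_le_iff_ne_zero.2 (by simpa using hF.ne_empty)
  rw [supCover]
  exact_mod_cast this

lemma one_le_empCover {E V : Type*} [NormedAddCommGroup V] [NormedSpace ℝ V] {n : ℕ}
    {r : ℝ} {G : Set (E → V)} {x : Fin n → E} (hG : G.Nonempty) : 1 ≤ empCover r G x := by
  have : 1 ≤ Metric.coveringNumber r.toNNReal
      ((fun g : E → V => ((1 / (n : ℝ)) • WithLp.toLp 1 (fun i => g (x i)) :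
      PiLp 1 fun _ : Fin n => V)) '' G) :=
    Order.one_le_iff_ne_zero.2 (by simpa using hG.ne_empty)
  rw [empCover]
  exact_mod_cast this

lemma one_le_expCover {E V : Type*} [MeasurableSpace E] [NormedAddCommGroup V] [NormedSpace ℝ V]
    {P : Measure E} [IsProbabilityMeasure P] {n : ℕ} {r : ℝ} {G : Set (E → V)}
    (hG : G.Nonempty) : 1 ≤ expCover P n r G := by
  calc (1 : ℝ≥0∞) = ∫⁻ _, 1 ∂(Measure.pi fun _ : Fin n => P) := by simp
    _ ≤ _ := lintegral_mono fun x => one_le_empCover hG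

lemma supCover_anti {E : Type*} {r s : ℝ} (h : r ≤ s) (F : Set (E → ℝ)) :
    supCover s F ≤ supCover r F := by
  have := Metric.coveringNumber_anti (A := UniformFun.ofFun '' F) (Real.toNNReal_le_toNNReal h)
  rw [supCover, supCover]
  exact_mod_cast this

/-- A class with at least two members has covering number at least two at some scale. -/
lemma exists_two_le_supCover {E : Type*} {F : Set (E → ℝ)} (hF : F.Nontrivial) :
    ∃ r > 0, 2 ≤ supCover r F := by
  obtain ⟨f, hf, g, hg, hfg⟩ := hF
  obtain ⟨x, hx⟩ := Function.ne_iff.1 hfg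
  have hpos : 0 < |f x - g x| := abs_pos.2 (sub_ne_zero.2 hx)
  -- One ball of this radius containing both functions would give `|f x - g x| ≤ 2 / 3 * |f x - g
  -- x|`.
  refine ⟨|f x - g x| / 3, by positivity, ?_⟩
  by_contra! hlt
  obtain ⟨C, -, hcard, hcov⟩ := exists_finset_supCover (by positivity) (hlt.ne_top)
  have hC1 : C.card ≤ 1 := by
    have : (C.card : ℝ≥0∞) < (2 : ℕ) := hcard.trans_lt (by exact_mod_cast hlt)
    have := Nat.cast_lt.1 this
    omega
  obtain ⟨u, hu, hfu⟩ := hcov f hf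
  obtain ⟨v, hv, hgv⟩ := hcov g hg
  obtain rfl := Finset.card_le_one.1 hC1 u hu v hv
  have h1 := hfu x
  have h2 := hgv x
  have h3 := abs_sub_le (f x) (u x) (g x)
  rw [abs_sub_comm (u x)] at h3
  linarith

/-- Covering numbers are integers or infinite. This identifies the degenerate case in which the
logarithm of the covering number vanishes. -/
lemma supCover_eq_one_of_lt_two {E : Type*} {r : ℝ} {F : Set (E → ℝ)} (hF : F.Nonempty)
    (h : supCover r F < 2) : supCover r F = 1 := by
  refine le_antisymm ?_ (one_le_supCover hF)
  have hne := h.ne_top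
  rw [supCover] at *
  obtain ⟨k, hk⟩ := ENat.ne_top_iff_exists.1
    (show Metric.coveringNumber r.toNNReal (UniformFun.ofFun '' F) ≠ ⊤ by simpa using hne)
  rw [← hk] at h ⊢
  have h' : (k : ℝ≥0∞) < (2 : ℕ) := by exact_mod_cast h
  have : k ≤ 1 := by have := Nat.cast_lt.1 h'; omega
  exact_mod_cast this

/-- The empirical covering number of the class of compositions. -/
lemma empCover_compClass_le {E : Type*} [NormedAddCommGroup E] [NormedSpace ℝ E] {n : ℕ}
    (hn : 0 < n) {F : Set (E → ℝ)} {G : Set (E → E)} {β r s : ℝ} (hβ : 0 ≤ β) (hr : 0 ≤ r) (hs : 0 ≤ s)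
    (hF : ∀ f ∈ F, ∀ x y, |f x - f y| ≤ β * ‖x - y‖) (x : Fin n → E) :
    empCover (r + β * s) (compClass F G) x ≤ supCover r F * empCover s G x := by
  classical
  -- Empty classes are separated because `0 * ∞ = 0`; for nonempty ones an infinite factor makes the
  -- right side infinite.
  rcases F.eq_empty_or_nonempty with rfl | hFn
  · simp [compClass, empCover]
  rcases G.eq_empty_or_nonempty with rfl | hGn
  · simp [compClass, empCover]
  by_cases h1 : supCover r F = ∞
  · rw [h1, ENNReal.top_mul (zero_lt_one.trans_le (one_le_empCover hGn)).ne']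
    exact le_top
  by_cases h2 : empCover s G x = ∞
  · rw [h2, ENNReal.mul_top (zero_lt_one.trans_le (one_le_supCover hFn)).ne']
    exact le_top
  obtain ⟨C, hC, hCc, hCcov⟩ := exists_finset_supCover hr h1
  obtain ⟨D, hD, hDc, hDcov⟩ := exists_finset_empCover hs h2
  refine (empCover_le_card (C := Finset.image₂ (fun f g => f ∘ g) C D) (by positivity)
    ?_ ?_).trans ?_
  · rw [Finset.coe_image₂]
    exact Set.image2_subset hC hD
  · rintro _ ⟨f, hf, g, hg, rfl⟩
    obtain ⟨f', hf', hff'⟩ := hCcov f hf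
    obtain ⟨g', hg', hgg'⟩ := hDcov g hg
    refine ⟨f' ∘ g', Finset.mem_image₂_of_mem hf' hg', ?_⟩
    have hn' : (0:ℝ) < n := by exact_mod_cast hn
    calc (1 / (n:ℝ)) * ∑ i, ‖(f ∘ g) (x i) - (f' ∘ g') (x i)‖
        ≤ (1 / (n:ℝ)) * ∑ i, (r + β * ‖g (x i) - g' (x i)‖) := by
          gcongr with i
          have e1 := hff' (g (x i))
          -- The Lipschitz bound is available for the centre `f'` because centres are taken in the
          -- class.
          have e2 := hF f' (hC hf') (g (x i)) (g' (x i))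
          exact (abs_sub_le _ (f' (g (x i))) _).trans (add_le_add e1 e2)
      _ = r + β * ((1 / (n:ℝ)) * ∑ i, ‖g (x i) - g' (x i)‖) := by
          rw [Finset.sum_add_distrib, ← Finset.mul_sum]
          simp
          field_simp
      _ ≤ r + β * s := by gcongr
  · calc ((Finset.image₂ (fun f g => f ∘ g) C D).card : ℝ≥0∞) ≤ (C.card * D.card : ℕ) := by
          exact Nat.cast_le.2 (Finset.card_image₂_le _ C D)
      _ ≤ _ := by push_cast; gcongr

/-- The expected empirical covering number of the class of compositions. -/
lemma expCover_compClass_le {E : Type*} [NormedAddCommGroup E] [NormedSpace ℝ E]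
    [MeasurableSpace E] (P : Measure E) [IsProbabilityMeasure P] {n : ℕ}
    (hn : 0 < n) {F : Set (E → ℝ)} {G : Set (E → E)} {β r s : ℝ} (hβ : 0 ≤ β) (hr : 0 ≤ r)
    (hs : 0 ≤ s) (hF : ∀ f ∈ F, ∀ x y, |f x - f y| ≤ β * ‖x - y‖) :
    expCover P n (r + β * s) (compClass F G) ≤ supCover r F * expCover P n s G := by
  by_cases h1 : supCover r F = ∞
  · rcases G.eq_empty_or_nonempty with rfl | hGn
    · simp [compClass, expCover, empCover]
    rw [h1, ENNReal.top_mul (zero_lt_one.trans_le (one_le_expCover hGn)).ne']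
    exact le_top
  -- The version for finite constants avoids measurability of the empirical covering number in `x`,
  -- which is not assumed.
  · rw [expCover, expCover, ← lintegral_const_mul' _ _ h1]
    exact lintegral_mono fun x => empCover_compClass_le hn hβ hr hs hF x

/-! ### Rademacher sums -/

/-- The sign `±1` attached to a Boolean. -/
def boolSign (b : Bool) : ℝ := if b then 1 else -1

/-- The moment generating function of a Rademacher sum, in counting form: the sum over sign vectors
factorises over coordinates. -/
lemma sum_exp_boolSign {n : ℕ} (a : Fin n → ℝ) :
    ∑ σ : Fin n → Bool, Real.exp (∑ i, boolSign (σ i) * a i) = 2 ^ n * ∏ i, Real.cosh (a i) := by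
  simp_rw [Real.exp_sum]
  have := Finset.prod_univ_sum (fun _ : Fin n => (Finset.univ : Finset Bool))
    (fun i b => Real.exp (boolSign b * a i))
  rw [Fintype.piFinset_univ] at this
  rw [← this]
  have h2 : (2:ℝ) ^ n = ∏ _i : Fin n, (2:ℝ) := by simp
  rw [h2, ← Finset.prod_mul_distrib]
  refine Finset.prod_congr rfl fun i _ => ?_
  simp [boolSign, Real.cosh_eq]
  ring

lemma card_boolSign_sum_gt_le {n : ℕ} {a : Fin n → ℝ} {B s : ℝ} (hB : 0 < B) (hs : 0 ≤ s)
    (ha : ∀ i, |a i| ≤ B) :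
    ((Finset.univ.filter fun σ : Fin n → Bool => n * s < ∑ i, boolSign (σ i) * a i).card : ℝ) ≤
      2 ^ n * Real.exp (-(n * s ^ 2 / (2 * B ^ 2))) := by
  -- The optimal Chernoff parameter: it minimises `-l * n * s + n * (l * B) ^ 2 / 2`.
  set l := s / B ^ 2 with hl
  have hl0 : 0 ≤ l := by positivity
  calc ((Finset.univ.filter fun σ : Fin n → Bool => n * s < ∑ i, boolSign (σ i) * a i).card : ℝ)
      = ∑ σ : Fin n → Bool, if n * s < ∑ i, boolSign (σ i) * a i then (1:ℝ) else 0 := by simp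
    _ ≤ ∑ σ : Fin n → Bool, Real.exp (-(l * (n * s))) *
          Real.exp (∑ i, boolSign (σ i) * (l * a i)) := by
        refine Finset.sum_le_sum fun σ _ => ?_
        rw [← Real.exp_add]
        split_ifs with h
        · refine Real.one_le_exp ?_
          have : ∑ i, boolSign (σ i) * (l * a i) = l * ∑ i, boolSign (σ i) * a i := by
            rw [Finset.mul_sum]; exact Finset.sum_congr rfl fun i _ => by ring
          rw [this]
          nlinarith
        · positivity
    _ = Real.exp (-(l * (n * s))) * (2 ^ n * ∏ i, Real.cosh (l * a i)) := by
        rw [← Finset.mul_sum, sum_exp_boolSign]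
    _ ≤ Real.exp (-(l * (n * s))) * (2 ^ n * ∏ _i : Fin n, Real.exp ((l * B) ^ 2 / 2)) := by
        refine mul_le_mul_of_nonneg_left (mul_le_mul_of_nonneg_left (Finset.prod_le_prod
          (fun i _ => (Real.cosh_pos _).le) fun i _ => ?_) (by positivity)) (by positivity)
        · refine (Real.cosh_le_exp_half_sq _).trans (Real.exp_le_exp.2 ?_)
          rw [mul_pow, mul_pow]
          have : a i ^ 2 ≤ B ^ 2 := sq_le_sq' (neg_le_of_abs_le (ha i)) (le_of_abs_le (ha i))
          gcongr
    _ = 2 ^ n * Real.exp (-(n * s ^ 2 / (2 * B ^ 2))) := by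
        rw [Finset.prod_const, Finset.card_univ, Fintype.card_fin, ← Real.exp_nat_mul,
          mul_left_comm, ← Real.exp_add]
        congr 2
        rw [hl]
        field_simp
        ring

/-- Hoeffding's inequality for Rademacher sums. -/
lemma card_abs_boolSign_sum_gt_le {n : ℕ} {a : Fin n → ℝ} {B s : ℝ} (hB : 0 < B) (hs : 0 ≤ s)
    (ha : ∀ i, |a i| ≤ B) :
    ((Finset.univ.filter fun σ : Fin n → Bool => n * s < |∑ i, boolSign (σ i) * a i|).card : ℝ) ≤
      2 ^ n * (2 * Real.exp (-(n * s ^ 2 / (2 * B ^ 2)))) := by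
  classical
  have h1 := card_boolSign_sum_gt_le hB hs ha
  have h2 := card_boolSign_sum_gt_le (a := fun i => -a i) hB hs (by simpa using ha)
  have : (Finset.univ.filter fun σ : Fin n → Bool => n * s < |∑ i, boolSign (σ i) * a i|) ⊆
      (Finset.univ.filter fun σ : Fin n → Bool => n * s < ∑ i, boolSign (σ i) * a i) ∪
      (Finset.univ.filter fun σ : Fin n → Bool => n * s < ∑ i, boolSign (σ i) * -a i) := by
    intro σ
    simp [lt_abs]
  have h3 : ((Finset.univ.filter fun σ : Fin n → Bool =>
      n * s < |∑ i, boolSign (σ i) * a i|).card : ℝ) ≤ _ :=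
    Nat.cast_le.2 ((Finset.card_le_card this).trans (Finset.card_union_le _ _))
  push_cast at h3
  linarith

/-! ### The uniform law of large numbers -/

/-- A union bound over an empirical covering. -/
lemma sum_indicator_boolSign_le {E : Type*} {H : Set (E → ℝ)} {n : ℕ} (hn : 0 < n) {B a r : ℝ} (hB : 0 < B)
    (ha : 0 ≤ a) (hr : 0 ≤ r) (hH : ∀ h ∈ H, ∀ x, |h x| ≤ B) (x : Fin n → E) :
    ∑ σ : Fin n → Bool, Set.indicator
        {x : Fin n → E | ∃ h ∈ H, n * (a + r) < |∑ i, boolSign (σ i) * h (x i)|}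
        (1 : (Fin n → E) → ℝ≥0∞) x ≤
      2 ^ n * (2 * empCover r H x * ENNReal.ofReal (Real.exp (-(n * a ^ 2 / (2 * B ^ 2))))) := by
  classical
  have hn' : (0:ℝ) < n := by exact_mod_cast hn
  by_cases htop : empCover r H x = ∞
  · rw [htop, ENNReal.mul_top (by simp), ENNReal.top_mul (by simp [Real.exp_pos]),
      ENNReal.mul_top (by simp)]
    exact le_top
  obtain ⟨C, hC, hCc, hCcov⟩ := exists_finset_empCover hr htop
  have hsub : ∀ σ : Fin n → Bool, (∃ h ∈ H, n * (a + r) < |∑ i, boolSign (σ i) * h (x i)|) →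
      ∃ c ∈ C, n * a < |∑ i, boolSign (σ i) * c (x i)| := by
    rintro σ ⟨h, hh, hlt⟩
    obtain ⟨c, hc, hhc⟩ := hCcov h hh
    refine ⟨c, hc, ?_⟩
    -- Signs have modulus one, so the empirical `l₁` distance controls this difference for all sign
    -- vectors at once.
    have h1 : |∑ i, boolSign (σ i) * h (x i) - ∑ i, boolSign (σ i) * c (x i)| ≤ n * r := by
      rw [← Finset.sum_sub_distrib]
      refine (Finset.abs_sum_le_sum_abs _ _).trans ?_
      calc ∑ i, |boolSign (σ i) * h (x i) - boolSign (σ i) * c (x i)|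
          = ∑ i, ‖h (x i) - c (x i)‖ := by
            refine Finset.sum_congr rfl fun i _ => ?_
            rw [← mul_sub, abs_mul, Real.norm_eq_abs]
            cases σ i <;> simp [boolSign]
        _ = n * (1 / (n:ℝ) * ∑ i, ‖h (x i) - c (x i)‖) := by field_simp
        _ ≤ n * r := by gcongr
    have h2 := abs_sub_abs_le_abs_sub (∑ i, boolSign (σ i) * h (x i))
      (∑ i, boolSign (σ i) * c (x i))
    linarith
  calc ∑ σ : Fin n → Bool,
        Set.indicator {x : Fin n → E | ∃ h ∈ H, n * (a + r) < |∑ i, boolSign (σ i) * h (x i)|}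
        (1 : (Fin n → E) → ℝ≥0∞) x
      ≤ ∑ σ : Fin n → Bool, ∑ c ∈ C, if n * a < |∑ i, boolSign (σ i) * c (x i)| then 1 else 0 := by
        refine Finset.sum_le_sum fun σ _ => ?_
        by_cases hx : ∃ h ∈ H, n * (a + r) < |∑ i, boolSign (σ i) * h (x i)|
        · obtain ⟨c, hc, hlt⟩ := hsub σ hx
          refine (Set.indicator_le_self' (fun _ _ => zero_le_one) _).trans ?_
          calc (1 : ℝ≥0∞) = if n * a < |∑ i, boolSign (σ i) * c (x i)| then 1 else 0 := by
                rw [if_pos hlt]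
            _ ≤ _ := Finset.single_le_sum
                (f := fun c : E → ℝ => if n * a < |∑ i, boolSign (σ i) * c (x i)|
                  then (1 : ℝ≥0∞) else 0) (fun _ _ => zero_le) hc
        · rw [Set.indicator_of_notMem (by simpa using hx)]
          exact zero_le
    _ = ∑ c ∈ C, ((Finset.univ.filter fun σ : Fin n → Bool =>
          n * a < |∑ i, boolSign (σ i) * c (x i)|).card : ℝ≥0∞) := by
        rw [Finset.sum_comm]
        simp
    _ ≤ ∑ c ∈ C, 2 ^ n * (2 * ENNReal.ofReal (Real.exp (-(n * a ^ 2 / (2 * B ^ 2))))) := by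
        refine Finset.sum_le_sum fun c hc => ?_
        have := card_abs_boolSign_sum_gt_le (a := fun i => c (x i)) hB ha
          fun i => hH c (hC hc) (x i)
        have := ENNReal.ofReal_le_ofReal this
        rwa [ENNReal.ofReal_natCast, ENNReal.ofReal_mul (by positivity),
          ENNReal.ofReal_mul (by positivity), ENNReal.ofReal_pow (by positivity),
          ENNReal.ofReal_ofNat] at this
    _ = 2 ^ n * (2 * C.card * ENNReal.ofReal (Real.exp (-(n * a ^ 2 / (2 * B ^ 2))))) := by
        rw [Finset.sum_const, nsmul_eq_mul]
        ring
    _ ≤ _ := by gcongr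

/-- The reason for working with a countable subclass: the deviation event is then a countable union.
-/
lemma measurableSet_exists_mem_lt {E α : Type*} [MeasurableSpace α] {H : Set (E → ℝ)}
    (hHc : H.Countable) {φ : (E → ℝ) → α → ℝ} (hφ : ∀ h ∈ H, Measurable (φ h)) (c : ℝ) :
    MeasurableSet {x | ∃ h ∈ H, c < φ h x} := by
  have : {x | ∃ h ∈ H, c < φ h x} = ⋃ h ∈ H, {x | c < φ h x} := by
    ext x; simp
  rw [this]
  exact MeasurableSet.biUnion hHc fun h hh => measurableSet_lt measurable_const (hφ h hh)

section UniformLaw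

variable {E : Type*} [MeasurableSpace E]

/-- Symmetrisation of the two-sample deviation by random signs. -/
lemma pi_prod_deviation_le (P : Measure E) [IsProbabilityMeasure P] {H H₀ : Set (E → ℝ)}
    (hH₀ : H₀ ⊆ H) (hc : H₀.Countable) (hm : ∀ h ∈ H₀, Measurable h) {n : ℕ} (hn : 0 < n)
    {B a r : ℝ} (hB : 0 < B) (ha : 0 ≤ a) (hr : 0 ≤ r) (hH : ∀ h ∈ H, ∀ x, |h x| ≤ B) :
    (Measure.pi fun _ : Fin n => P.prod P)
      {z | ∃ h ∈ H₀, n * (2 * (a + r)) < |∑ i, (h (z i).1 - h (z i).2)|} ≤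
    4 * expCover P n r H * ENNReal.ofReal (Real.exp (-(n * a ^ 2 / (2 * B ^ 2)))) := by
  set S : (Fin n → Bool) → Set (Fin n → E) := fun σ =>
    {x | ∃ h ∈ H₀, n * (a + r) < |∑ i, boolSign (σ i) * h (x i)|} with hS
  have hSm : ∀ σ, MeasurableSet (S σ) := fun σ =>
    measurableSet_exists_mem_lt hc (fun h hh => by have := hm h hh; fun_prop) _
  set A := {z : Fin n → E × E | ∃ h ∈ H₀, n * (2 * (a + r)) < |∑ i, (h (z i).1 - h (z i).2)|}
    with hA
  have hAm : MeasurableSet A :=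
    measurableSet_exists_mem_lt hc (fun h hh => by have := hm h hh; fun_prop) _
  have hsign : ∀ σ, (Measure.pi fun _ : Fin n => P.prod P) A ≤
      2 * (Measure.pi fun _ : Fin n => P) (S σ) := by
    intro σ
    -- Exchanging the two copies where the sign is negative preserves the product law and inserts
    -- the signs into the sum. One of the two signed halves must then exceed half of the threshold,
    -- which costs a factor 2.
    have hT : MeasurePreserving (fun (z : Fin n → E × E) i => (if σ i then id else Prod.swap) (z i))
        (Measure.pi fun _ : Fin n => P.prod P) (Measure.pi fun _ : Fin n => P.prod P) := by
      refine measurePreserving_pi (f := fun i => if σ i then id else Prod.swap) _ _ fun i => ?_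
      cases σ i
      · exact Measure.measurePreserving_swap
      · exact MeasurePreserving.id _
    have h1 : MeasurePreserving (fun (z : Fin n → E × E) i => (z i).1)
        (Measure.pi fun _ : Fin n => P.prod P) (Measure.pi fun _ : Fin n => P) :=
      measurePreserving_pi (f := fun _ => Prod.fst) _ _ fun i => measurePreserving_fst
    have h2 : MeasurePreserving (fun (z : Fin n → E × E) i => (z i).2)
        (Measure.pi fun _ : Fin n => P.prod P) (Measure.pi fun _ : Fin n => P) :=
      measurePreserving_pi (f := fun _ => Prod.snd) _ _ fun i => measurePreserving_snd
    rw [← hT.measure_preimage hAm.nullMeasurableSet, two_mul]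
    nth_rewrite 2 [← h1.measure_preimage (hSm σ).nullMeasurableSet]
    rw [← h2.measure_preimage (hSm σ).nullMeasurableSet, add_comm]
    refine (measure_mono ?_).trans (measure_union_le _ _)
    rintro z ⟨h, hh, hlt⟩
    have e : ∑ i, (h ((if σ i then id else Prod.swap) (z i)).1 -
        h ((if σ i then id else Prod.swap) (z i)).2) =
        ∑ i, boolSign (σ i) * h (z i).1 - ∑ i, boolSign (σ i) * h (z i).2 := by
      rw [← Finset.sum_sub_distrib]
      refine Finset.sum_congr rfl fun i _ => ?_
      cases σ i <;> (simp [boolSign]; try ring)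
    have hlt' : n * (2 * (a + r)) <
        |∑ i, boolSign (σ i) * h (z i).1 - ∑ i, boolSign (σ i) * h (z i).2| := e ▸ hlt
    have := abs_sub (∑ i, boolSign (σ i) * h (z i).1) (∑ i, boolSign (σ i) * h (z i).2)
    by_cases hz : n * (a + r) < |∑ i, boolSign (σ i) * h (z i).1|
    · exact Or.inl ⟨h, hh, hz⟩
    · refine Or.inr ⟨h, hh, ?_⟩
      simp only
      linarith
  have hpow : (2 : ℝ≥0∞) ^ n ≠ 0 := by simp
  have hpow' : (2 : ℝ≥0∞) ^ n ≠ ∞ := by finiteness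
  refine (ENNReal.mul_le_mul_iff_right hpow hpow').1 ?_
  -- Averaging over all sign vectors and moving the sum inside the integral leaves a Rademacher
  -- estimate for each fixed sample.
  calc (2 : ℝ≥0∞) ^ n * (Measure.pi fun _ : Fin n => P.prod P) A
      = ∑ _σ : Fin n → Bool, (Measure.pi fun _ : Fin n => P.prod P) A := by simp
    _ ≤ ∑ σ : Fin n → Bool, 2 * (Measure.pi fun _ : Fin n => P) (S σ) :=
        Finset.sum_le_sum fun σ _ => hsign σ
    _ = 2 * ∫⁻ x, ∑ σ : Fin n → Bool, (S σ).indicator 1 x ∂(Measure.pi fun _ : Fin n => P) := by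
        rw [lintegral_finsetSum _ fun σ _ => (measurable_one.indicator (hSm σ)),
          ← Finset.mul_sum]
        simp_rw [lintegral_indicator_one (hSm _)]
    _ ≤ 2 * ∫⁻ x, 2 ^ n * 2 * ENNReal.ofReal (Real.exp (-(n * a ^ 2 / (2 * B ^ 2)))) *
          empCover r H x ∂(Measure.pi fun _ : Fin n => P) := by
        gcongr with x
        refine le_trans (Finset.sum_le_sum fun σ _ => ?_)
          ((sum_indicator_boolSign_le hn hB ha hr hH x).trans_eq (by ring))
        refine Set.indicator_le_indicator_of_subset ?_ (fun _ => zero_le) x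
        rintro x ⟨h, hh, hlt⟩
        exact ⟨h, hH₀ hh, hlt⟩
    _ = 2 ^ n * (4 * expCover P n r H *
          ENNReal.ofReal (Real.exp (-(n * a ^ 2 / (2 * B ^ 2))))) := by
        rw [lintegral_const_mul' _ _ (by finiteness), expCover]
        ring

/-- Chebyshev's inequality for the ghost sample. -/
lemma half_le_pi_deviation_le (P : Measure E) [IsProbabilityMeasure P] {n : ℕ} {h : E → ℝ}
    (hm : Measurable h) {B u : ℝ} (hu : 0 < u) (hb : ∀ x, |h x| ≤ B)
    (hnu : B ^ 2 / 2 ≤ n * u ^ 2) (hn : 0 < n) :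
    1 / 2 ≤ (Measure.pi fun _ : Fin n => P) {x | |∑ i, h (x i) - n * ∫ x, h x ∂P| < n * (2 * u)} := by
  have hn' : (0:ℝ) < n := by exact_mod_cast hn
  set Y : (Fin n → E) → ℝ := ∑ i, fun x => h (x i) with hY
  have hYm : Measurable Y := by rw [hY]; fun_prop
  have hL2 : MemLp h 2 P := MemLp.of_bound hm.aestronglyMeasurable B (ae_of_all _ hb)
  have hint : Integrable h P := hL2.integrable (by norm_num)
  have hvar : Var[Y; Measure.pi fun _ : Fin n => P] ≤ n * B ^ 2 := by
    rw [hY, variance_sum_pi fun _ => hL2]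
    rw [Finset.sum_const, Finset.card_univ, Fintype.card_fin, nsmul_eq_mul]
    gcongr
    refine (variance_le_sq_of_bounded (a := -B) (b := B) (ae_of_all _ fun x => abs_le.1 (hb x))
      hm.aemeasurable).trans_eq (by ring)
  have hexp : ∫ x, Y x ∂(Measure.pi fun _ : Fin n => P) = n * ∫ x, h x ∂P := by
    have he : ∀ i : Fin n, MeasurePreserving (fun x : Fin n → E => x i)
      (Measure.pi fun _ : Fin n => P) P := fun i => measurePreserving_eval _ i
    simp only [hY, Finset.sum_apply]
    rw [integral_finsetSum (f := fun (i : Fin n) (x : Fin n → E) => h (x i)) _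
      fun i _ => (he i).integrable_comp_of_integrable hint]
    have : ∀ i : Fin n, ∫ x, h (x i) ∂(Measure.pi fun _ : Fin n => P) = ∫ x, h x ∂P := fun i => by
      rw [← (he i).map_eq, integral_map (he i).measurable.aemeasurable hm.aestronglyMeasurable,
        (he i).map_eq]
    simp [this]
  have hYL2 : MemLp Y 2 (Measure.pi fun _ : Fin n => P) := by
    refine MemLp.of_bound hYm.aestronglyMeasurable (n * B) (ae_of_all _ fun x => ?_)
    simp only [hY, Finset.sum_apply]
    refine (norm_sum_le _ _).trans ((Finset.sum_le_sum fun i _ => hb (x i)).trans_eq ?_)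
    simp
  -- With variance at most `n * B ^ 2`, Chebyshev gives `B ^ 2 / (4 * n * u ^ 2)`, which is at most
  -- 1/2 by `hnu`.
  have hch := meas_ge_le_variance_div_sq hYL2 (c := n * (2 * u)) (by positivity)
  have hle : (Measure.pi fun _ : Fin n => P) {x | n * (2 * u) ≤ |Y x - n * ∫ x, h x ∂P|} ≤ 1 / 2 := by
    rw [hexp] at hch
    refine hch.trans ?_
    rw [show (1 / 2 : ℝ≥0∞) = ENNReal.ofReal (1 / 2) by
      rw [ENNReal.ofReal_div_of_pos (by norm_num)]; simp]
    refine ENNReal.ofReal_le_ofReal ?_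
    rw [div_le_iff₀ (by positivity)]
    nlinarith
  have hcompl : {x : Fin n → E | |∑ i, h (x i) - n * ∫ x, h x ∂P| < n * (2 * u)} =
      {x | n * (2 * u) ≤ |Y x - n * ∫ x, h x ∂P|}ᶜ := by
    ext x; simp [hY]
  rw [hcompl, prob_compl_eq_one_sub (measurableSet_le measurable_const (by fun_prop))]
  calc (1 / 2 : ℝ≥0∞) = 1 - 1 / 2 := by simp
    _ ≤ _ := tsub_le_tsub_left hle 1

/-- Symmetrisation by a ghost sample. -/
lemma pi_deviation_le_two_mul (P : Measure E) [IsProbabilityMeasure P] {H : Set (E → ℝ)}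
    (hc : H.Countable) (hm : ∀ h ∈ H, Measurable h) {n : ℕ} (hn : 0 < n)
    {B u : ℝ} (hu : 0 < u) (hH : ∀ h ∈ H, ∀ x, |h x| ≤ B)
    (hnu : B ^ 2 / 2 ≤ n * u ^ 2) :
    (Measure.pi fun _ : Fin n => P) {x | ∃ h ∈ H, n * (4 * u) < |∑ i, h (x i) - n * ∫ x, h x ∂P|} ≤
    2 * (Measure.pi fun _ : Fin n => P.prod P)
      {z | ∃ h ∈ H, n * (2 * u) < |∑ i, (h (z i).1 - h (z i).2)|} := by
  have e := measurePreserving_arrowProdEquivProdArrow E E (Fin n) (fun _ => P) (fun _ => P)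
  set A := {x : Fin n → E | ∃ h ∈ H, n * (4 * u) < |∑ i, h (x i) - n * ∫ x, h x ∂P|} with hA
  have hAm : MeasurableSet A :=
    measurableSet_exists_mem_lt hc (fun h hh => by have := hm h hh; fun_prop) _
  set D := {p : (Fin n → E) × (Fin n → E) |
    ∃ h ∈ H, n * (2 * u) < |∑ i, (h (p.1 i) - h (p.2 i))|} with hD
  have hDm : MeasurableSet D :=
    measurableSet_exists_mem_lt hc (fun h hh => by have := hm h hh; fun_prop) _
  have hpre : {z : Fin n → E × E | ∃ h ∈ H, n * (2 * u) < |∑ i, (h (z i).1 - h (z i).2)|} =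
      MeasurableEquiv.arrowProdEquivProdArrow E E (Fin n) ⁻¹' D := rfl
  rw [hpre, e.measure_preimage hDm.nullMeasurableSet, Measure.prod_apply hDm]
  calc (Measure.pi fun _ : Fin n => P) A
      = 2 * ∫⁻ x, A.indicator (fun _ => 1 / 2) x ∂(Measure.pi fun _ : Fin n => P) := by
        rw [lintegral_indicator_const hAm, ← mul_assoc, ENNReal.mul_div_cancel (by simp) (by simp),
          one_mul]
    _ ≤ _ := by
        gcongr with x
        by_cases hx : x ∈ A
        swap
        · rw [Set.indicator_of_notMem hx]
          exact zero_le
        rw [Set.indicator_of_mem hx]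
        obtain ⟨h, hh, hlt⟩ := hx
        -- For a bad sample `x` with witness `h`, the ghost sample is within `2u` of the mean of
        -- this same `h` with probability at least 1/2, and then the two samples differ by more than
        -- `2u`.
        refine (half_le_pi_deviation_le P (hm h hh) hu (hH h hh) hnu hn).trans
          (measure_mono fun z hz => ⟨h, hh, ?_⟩)
        simp only [Set.mem_ofPred_eq] at hz
        simp only [Finset.sum_sub_distrib]
        have := abs_sub_le (∑ i, h (x i)) (∑ i, h (z i)) (n * ∫ x, h x ∂P)
        linarith

/-- Uniform law of large numbers over a countable subclass, in terms of the covering numbers of the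
full class. -/
lemma pi_deviation_le_expCover (P : Measure E) [IsProbabilityMeasure P] {H H₀ : Set (E → ℝ)}
    (hH₀ : H₀ ⊆ H) (hc : H₀.Countable) (hm : ∀ h ∈ H₀, Measurable h) {n : ℕ} (hn : 0 < n)
    {B a r : ℝ} (hB : 0 < B) (ha : 0 ≤ a) (hr : 0 ≤ r) (hH : ∀ h ∈ H, ∀ x, |h x| ≤ B) :
    (Measure.pi fun _ : Fin n => P)
      {x | ∃ h ∈ H₀, n * (4 * (a + r)) < |∑ i, h (x i) - n * ∫ x, h x ∂P|} ≤
    8 * expCover P n r H * ENNReal.ofReal (Real.exp (-(n * a ^ 2 / (2 * B ^ 2)))) := by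
  have hn' : (0:ℝ) < n := by exact_mod_cast hn
  by_cases hnu : B ^ 2 / 2 ≤ n * (a + r) ^ 2
  · have hu : 0 < a + r := by
      refine lt_of_le_of_ne (by positivity) fun h0 => ?_
      rw [← h0] at hnu
      nlinarith [sq_pos_of_pos hB]
    refine (pi_deviation_le_two_mul P hc hm hn hu (fun h hh => hH h (hH₀ hh)) hnu).trans ?_
    calc _ ≤ 2 * (4 * expCover P n r H *
          ENNReal.ofReal (Real.exp (-(n * a ^ 2 / (2 * B ^ 2))))) := by
          gcongr
          exact pi_prod_deviation_le P hH₀ hc hm hn hB ha hr hH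
      _ = _ := by ring
  -- When Chebyshev is not available, `n * a ^ 2 < B ^ 2 / 2`, so the exponential is at least `exp
  -- (-1/4)` and the claimed bound exceeds 1.
  · rcases H.eq_empty_or_nonempty with rfl | hne
    · simp [Set.subset_empty_iff.1 hH₀]
    refine prob_le_one.trans ?_
    have h1 : (1:ℝ) ≤ 8 * Real.exp (-(n * a ^ 2 / (2 * B ^ 2))) := by
      have : n * a ^ 2 / (2 * B ^ 2) ≤ 1 / 4 := by
        rw [div_le_iff₀ (by positivity)]
        have : a ^ 2 ≤ (a + r) ^ 2 := by gcongr; linarith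
        nlinarith
      have := Real.add_one_le_exp (-(n * a ^ 2 / (2 * B ^ 2)))
      linarith
    calc (1 : ℝ≥0∞) = ENNReal.ofReal 1 := by simp
      _ ≤ ENNReal.ofReal (8 * Real.exp (-(n * a ^ 2 / (2 * B ^ 2)))) := ENNReal.ofReal_le_ofReal h1
      _ = 8 * 1 * ENNReal.ofReal (Real.exp (-(n * a ^ 2 / (2 * B ^ 2)))) := by
          rw [ENNReal.ofReal_mul (by norm_num), mul_one]; simp
      _ ≤ _ := by gcongr; exact one_le_expCover hne

/-- Uniform law of large numbers over a pointwise measurable class of bounded functions. -/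
lemma IsIIDSample.measure_uniform_deviation_le {Ω : Type*} [MeasurableSpace Ω] {μ : Measure Ω}
    [IsProbabilityMeasure μ] {P : Measure E} [IsProbabilityMeasure P] {n : ℕ} {X : Fin n → Ω → E}
    (hX : IsIIDSample μ X P) {H : Set (E → ℝ)} (hpm : IsPointwiseMeasurable H) (hn : 0 < n)
    {B a r : ℝ} (hB : 0 < B) (ha : 0 ≤ a) (hr : 0 ≤ r) (hH : ∀ h ∈ H, ∀ x, |h x| ≤ B) :
    μ {ω | ∃ h ∈ H, 4 * (a + r) < |(1 / (n : ℝ)) * ∑ i, h (X i ω) - ∫ x, h x ∂P|} ≤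
    8 * expCover P n r H * ENNReal.ofReal (Real.exp (-(n * a ^ 2 / (2 * B ^ 2)))) := by
  have hn' : (0:ℝ) < n := by exact_mod_cast hn
  obtain ⟨hm, H₀, hH₀, hc, hlim⟩ := hpm
  have hm₀ : ∀ h ∈ H₀, Measurable h := fun h hh => hm h (hH₀ hh)
  have hAm : MeasurableSet {x : Fin n → E | ∃ h ∈ H₀,
      n * (4 * (a + r)) < |∑ i, h (x i) - n * ∫ x, h x ∂P|} :=
    measurableSet_exists_mem_lt hc (fun h hh => by have := hm₀ h hh; fun_prop) _
  refine le_trans ?_ (pi_deviation_le_expCover P hH₀ hc hm₀ hn hB ha hr hH)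
  have hlaw : μ.map (fun ω i => X i ω) = Measure.pi fun _ : Fin n => P := by
    rw [(iIndepFun_iff_map_fun_eq_pi_map fun i => (hX.measurable i).aemeasurable).1 hX.indep]
    simp_rw [hX.law]
  rw [← hlaw, Measure.map_apply (measurable_pi_lambda _ hX.measurable) hAm]
  refine measure_mono ?_
  rintro ω ⟨h, hh, hlt⟩
  obtain ⟨u, hu, hul⟩ := hlim h hh
  -- Sample sums and, by dominated convergence, means pass to the limit; as the deviation inequality
  -- is strict, it already holds for a member of the countable subclass.
  have hint : Tendsto (fun k => ∫ x, u k x ∂P) atTop (𝓝 (∫ x, h x ∂P)) :=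
    tendsto_integral_of_dominated_convergence (fun _ => B)
      (fun k => (hm₀ _ (hu k)).aestronglyMeasurable) (integrable_const _)
      (fun k => ae_of_all _ fun x => hH _ (hH₀ (hu k)) x) (ae_of_all _ hul)
  have hconv : Tendsto (fun k => |∑ i, u k (X i ω) - n * ∫ x, u k x ∂P|) atTop
      (𝓝 |∑ i, h (X i ω) - n * ∫ x, h x ∂P|) :=
    ((tendsto_finsetSum _ fun i _ => hul (X i ω)).sub (hint.const_mul _)).abs
  have hlt' : n * (4 * (a + r)) < |∑ i, h (X i ω) - n * ∫ x, h x ∂P| := by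
    have : |∑ i, h (X i ω) - n * ∫ x, h x ∂P| =
        n * |(1 / (n : ℝ)) * ∑ i, h (X i ω) - ∫ x, h x ∂P| := by
      rw [← abs_of_pos hn', ← abs_mul, abs_of_pos hn']
      congr 1
      field_simp
    rw [this]
    gcongr
  obtain ⟨k, hk⟩ := (hconv.eventually (lt_mem_nhds hlt')).exists
  exact ⟨u k, hu k, hk⟩

end UniformLaw

/-! ### Composition classes -/

/-- A uniformly Lipschitz class of functions has a countable subclass that is sequentially dense
for pointwise convergence. -/
lemma exists_countable_pointwise_dense {E : Type*} [NormedAddCommGroup E]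
    [TopologicalSpace.SeparableSpace E] {F : Set (E → ℝ)} {β : ℝ} (hβ : 0 < β)
    (hF : ∀ f ∈ F, ∀ x y, |f x - f y| ≤ β * ‖x - y‖) :
    ∃ F₀ ⊆ F, F₀.Countable ∧ ∀ f ∈ F, ∃ u : ℕ → E → ℝ, (∀ n, u n ∈ F₀) ∧
      ∀ x, Tendsto (fun n => u n x) atTop (𝓝 (f x)) := by
  set D : ℕ → E := TopologicalSpace.denseSeq E with hD
  set e : (E → ℝ) → ℕ → ℝ := fun f k => f (D k) with he
  -- Restrictions to a dense sequence live in the separable metrizable space `ℕ → ℝ`. The common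
  -- Lipschitz constant upgrades convergence on that sequence to convergence everywhere.
  obtain ⟨c, hc, hcd⟩ := TopologicalSpace.exists_countable_dense (e '' F)
  choose v hvF hve using fun y : e '' F => y.2
  refine ⟨v '' c, ?_, hc.image v, fun f hf => ?_⟩
  · rintro _ ⟨y, -, rfl⟩
    exact hvF y
  obtain ⟨y, hy, hyl⟩ := mem_closure_iff_seq_limit.1 (hcd ⟨e f, Set.mem_image_of_mem e hf⟩)
  refine ⟨fun k => v (y k), fun k => Set.mem_image_of_mem v (hy k), fun x => ?_⟩
  have hpt : ∀ j, Tendsto (fun k => v (y k) (D j)) atTop (𝓝 (f (D j))) := fun j => by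
    have h1 := (tendsto_pi_nhds.1 ((continuous_subtype_val.tendsto _).comp hyl)) j
    refine h1.congr fun k => ?_
    exact (congrFun (hve (y k)) j).symm
  rw [Metric.tendsto_atTop]
  intro ε hε
  obtain ⟨j, hj⟩ := (TopologicalSpace.denseRange_denseSeq E).exists_dist_lt x
    (show 0 < ε / (3 * β) by positivity)
  obtain ⟨N, hN⟩ := Metric.tendsto_atTop.1 (hpt j) (ε / 3) (by positivity)
  refine ⟨N, fun k hk => ?_⟩
  have hj' : β * ‖x - D j‖ < ε / 3 := by
    rw [dist_eq_norm, lt_div_iff₀ (by positivity)] at hj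
    linarith
  have h1 := hF _ (hvF (y k)) x (D j)
  have h2 := hF _ hf x (D j)
  have h3 := hN k hk
  rw [Real.dist_eq] at h3 ⊢
  rw [abs_le] at h1 h2
  rw [abs_lt] at h3 ⊢
  constructor <;> linarith

/-- The compositions of a uniformly Lipschitz class with a pointwise measurable class form a
pointwise measurable class. -/
lemma IsPointwiseMeasurable.compClass {E : Type*} [NormedAddCommGroup E] [MeasurableSpace E]
    [BorelSpace E] [TopologicalSpace.SeparableSpace E] {F : Set (E → ℝ)} {G : Set (E → E)}
    {β : ℝ} (hβ : 0 < β) (hG : IsPointwiseMeasurable G)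
    (hF : ∀ f ∈ F, ∀ x y, |f x - f y| ≤ β * ‖x - y‖) :
    IsPointwiseMeasurable (compClass F G) := by
  have hcont : ∀ f ∈ F, Continuous f := fun f hf =>
    (LipschitzWith.of_dist_le_mul (K := β.toNNReal) fun x y => by
      rw [Real.dist_eq, dist_eq_norm, Real.coe_toNNReal _ hβ.le]; exact hF f hf x y).continuous
  obtain ⟨hGm, G₀, hG₀, hG₀c, hGl⟩ := hG
  obtain ⟨F₀, hF₀, hF₀c, hFl⟩ := exists_countable_pointwise_dense hβ hF
  refine ⟨?_, ATPF.compClass F₀ G₀, Set.image2_subset hF₀ hG₀, hF₀c.image2 hG₀c _, ?_⟩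
  · rintro _ ⟨f, hf, g, hg, rfl⟩
    exact (hcont f hf).measurable.comp (hGm g hg)
  · rintro _ ⟨f, hf, g, hg, rfl⟩
    obtain ⟨u, hu, hul⟩ := hFl f hf
    obtain ⟨v, hv, hvl⟩ := hGl g hg
    refine ⟨fun k => u k ∘ v k, fun k => Set.mem_image2_of_mem (hu k) (hv k), fun x => ?_⟩
    -- The diagonal sequence `u k ∘ v k` converges because the Lipschitz constant is uniform in `k`.
    have h1 : Tendsto (fun k => u k (v k x) - u k (g x)) atTop (𝓝 0) := by
      refine squeeze_zero_norm (fun k => hF _ (hF₀ (hu k)) _ _) ?_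
      have := ((hvl x).sub_const (g x)).norm.const_mul β
      simpa using this
    simpa using h1.add (hul (g x))

/-! ### Self-normalised importance sampling -/

/-- The self-normalised importance sampling estimate of the integral of `f`. -/
noncomputable def snis {E : Type*} (w : E → ℝ) {n : ℕ} (x : Fin n → E) (f : E → ℝ) : ℝ :=
  ∑ j, w (x j) / (∑ l, w (x l)) * f (x j)

/-- With `q` the posterior mean of `f`, the numerator is a sum of centred i.i.d. terms, so the ratio
needs no separate bias estimate. -/
lemma snis_sub_const {E : Type*} {w : E → ℝ} {n : ℕ} {x : Fin n → E} {f : E → ℝ}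
    (hs : ∑ l, w (x l) ≠ 0) (q : ℝ) :
    snis w x f - q = (∑ j, w (x j) * (f (x j) - q)) / ∑ l, w (x l) := by
  have e : ∑ j, w (x j) * (f (x j) - q) = ∑ j, w (x j) * f (x j) - (∑ l, w (x l)) * q := by
    simp only [mul_sub, Finset.sum_sub_distrib, ← Finset.sum_mul]
  have e' : snis w x f = (∑ j, w (x j) * f (x j)) / ∑ l, w (x l) := by
    rw [snis, Finset.sum_div]
    exact Finset.sum_congr rfl fun j _ => by ring
  rw [e, e']
  field_simp

/-- The normalised weights are nonnegative and sum to 1, or to 0 when the total weight vanishes,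
since `0 / 0 = 0`. -/
lemma abs_snis_sub_snis_le {E : Type*} {w : E → ℝ} (hw : ∀ x, 0 ≤ w x) {n : ℕ} {x : Fin n → E}
    {f g : E → ℝ} {r : ℝ} (hr : 0 ≤ r) (h : ∀ x, |f x - g x| ≤ r) :
    |snis w x f - snis w x g| ≤ r := by
  have hs : 0 ≤ ∑ l, w (x l) := Finset.sum_nonneg fun l _ => hw _
  rw [snis, snis, ← Finset.sum_sub_distrib]
  calc |∑ j, (w (x j) / (∑ l, w (x l)) * f (x j) - w (x j) / (∑ l, w (x l)) * g (x j))|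
      ≤ ∑ j, w (x j) / (∑ l, w (x l)) * r := by
        refine (Finset.abs_sum_le_sum_abs _ _).trans (Finset.sum_le_sum fun j _ => ?_)
        have : 0 ≤ w (x j) / (∑ l, w (x l)) := div_nonneg (hw _) hs
        rw [← mul_sub, abs_mul, abs_of_nonneg this]
        exact mul_le_mul_of_nonneg_left (h _) this
    _ = (∑ l, w (x l)) / (∑ l, w (x l)) * r := by
        rw [← Finset.sum_mul, Finset.sum_div]
    _ ≤ 1 * r := by
        gcongr
        exact div_self_le_one _
    _ = r := one_mul r

lemma continuous_of_abs_sub_le {E : Type*} [NormedAddCommGroup E] {f : E → ℝ} {β : ℝ} (hβ : 0 ≤ β)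
    (hf : ∀ x y, |f x - f y| ≤ β * ‖x - y‖) : Continuous f :=
  (LipschitzWith.of_dist_le_mul (K := β.toNNReal) fun x y => by
    rw [Real.dist_eq, dist_eq_norm, Real.coe_toNNReal _ hβ]; exact hf x y).continuous

/-- The setting of importance sampling: a strongly log-concave prior `P`, bounded Lipschitz
weights `w`, and the reweighted probability measure `Q`. -/
structure IsReweighting {d : ℕ} (P Q : Measure (Euc d)) (w : Euc d → ℝ) (B β γ : ℝ) : Prop where
  isProbabilityMeasure_left : IsProbabilityMeasure P
  isProbabilityMeasure_right : IsProbabilityMeasure Q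
  isStronglyLogConcave : IsStronglyLogConcave P γ
  gamma_pos : 0 < γ
  beta_pos : 0 < β
  weight_nonneg : ∀ x, 0 ≤ w x
  weight_le : ∀ x, w x ≤ B
  weight_lipschitz : ∀ x y, |w x - w y| ≤ β * ‖x - y‖
  mean_pos : 0 < ∫ x, w x ∂P
  integral_eq : ∀ f : Euc d → ℝ, ∫ x, f x ∂Q = (∫ x, w x * f x ∂P) / ∫ x, w x ∂P

namespace IsReweighting

variable {d : ℕ} {P Q : Measure (Euc d)} {w : Euc d → ℝ} {B β γ : ℝ}

lemma measurable_weight (h : IsReweighting P Q w B β γ) : Measurable w :=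
  (continuous_of_abs_sub_le h.beta_pos.le h.weight_lipschitz).measurable

lemma abs_weight_le (h : IsReweighting P Q w B β γ) (x : Euc d) : |w x| ≤ B :=
  abs_le.2 ⟨by linarith [h.weight_nonneg x, h.weight_le x], h.weight_le x⟩

lemma bound_pos (h : IsReweighting P Q w B β γ) : 0 < B := by
  have := h.isProbabilityMeasure_left
  by_contra! hB
  have h0 : ∀ x, w x = 0 := fun x => le_antisymm ((h.weight_le x).trans hB) (h.weight_nonneg x)
  have := h.mean_pos
  simp [h0] at this

/-- The total weight is rarely below half of its mean. -/
lemma measure_sum_weight_lt_le (h : IsReweighting P Q w B β γ) {Ω : Type*} [MeasurableSpace Ω]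
    {μ : Measure Ω} [IsProbabilityMeasure μ] {n : ℕ} {X : Fin n → Ω → Euc d}
    (hX : IsIIDSample μ X P) :
    μ {ω | ∑ l, w (X l ω) ≤ n * (∫ x, w x ∂P) / 2} ≤
      ENNReal.ofReal (Real.exp (-(n * (∫ x, w x ∂P) ^ 2 / (2 * B ^ 2)))) := by
  have := h.isProbabilityMeasure_left
  have hB := h.bound_pos
  set m := ∫ x, w x ∂P with hm
  have hm0 : 0 < m := h.mean_pos
  have hsub := (hasSubgaussianMGF_of_mem_Icc (μ := P) (X := w) (a := 0) (b := B)
    h.measurable_weight.aemeasurable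
    (ae_of_all _ fun x => ⟨h.weight_nonneg x, h.weight_le x⟩)).neg
  have hφ : Measurable (-fun x => w x - m) := (h.measurable_weight.sub_const m).neg
  -- Hoeffding for `m - w`, whose sub-Gaussian parameter is `B ^ 2 / 4` because `w` takes values in
  -- `[0, B]`.
  have key := hX.measure_sum_ge_le hφ hsub (s := n * m / 2) (by positivity)
  refine (measure_mono fun ω hω => ?_).trans (key.trans_eq ?_)
  · simp only [Set.mem_ofPred_eq, Pi.neg_apply, Finset.sum_neg_distrib,
      Finset.sum_sub_distrib, Finset.sum_const, Finset.card_univ, Fintype.card_fin,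
      nsmul_eq_mul] at hω ⊢
    linarith
  · congr 2
    have : (((‖B - 0‖₊ / 2) ^ 2 : ℝ≥0) : ℝ) = B ^ 2 / 4 := by
      push_cast
      rw [sub_zero, Real.norm_of_nonneg hB.le]
      ring
    rw [this]
    rcases Nat.eq_zero_or_pos n with rfl | hn
    · simp
    · field_simp
      ring

/-- Concentration of the weighted and centred sum of one test function. -/
lemma measure_abs_sum_ge_le (h : IsReweighting P Q w B β γ) {Ω : Type*} [MeasurableSpace Ω]
    {μ : Measure Ω} [IsProbabilityMeasure μ] {n : ℕ} {X : Fin n → Ω → Euc d}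
    (hX : IsIIDSample μ X P) {f : Euc d → ℝ} (hfB : ∀ x, |f x| ≤ B)
    (hf : ∀ x y, |f x - f y| ≤ β * ‖x - y‖) {b : ℝ} (hb : 0 ≤ b) :
    μ {ω | n * (∫ x, w x ∂P) / 2 * b ≤ |∑ j, w (X j ω) * (f (X j ω) - ∫ x, f x ∂Q)|} ≤
      2 * ENNReal.ofReal
        (Real.exp (-(γ * n * (∫ x, w x ∂P) ^ 2 * b ^ 2 / (144 * B ^ 2 * β ^ 2)))) := by
  have := h.isProbabilityMeasure_left
  have := h.isProbabilityMeasure_right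
  have hB := h.bound_pos
  have hβ := h.beta_pos
  have hγ := h.gamma_pos
  have hfm : Measurable f := (continuous_of_abs_sub_le hβ.le hf).measurable
  have hwm := h.measurable_weight
  set m := ∫ x, w x ∂P with hm
  have hm0 : 0 < m := h.mean_pos
  set q := ∫ x, f x ∂Q with hq
  have hqB : |q| ≤ B := by
    have := norm_integral_le_of_norm_le_const (μ := Q) (f := f) (ae_of_all _ hfB)
    simpa using this
  have hfq : ∀ x, |f x - q| ≤ 2 * B := fun x => (abs_sub _ _).trans (by linarith [hfB x])
  set φ : Euc d → ℝ := fun x => w x * (f x - q) with hφ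
  have hφm : Measurable φ := hwm.mul (hfm.sub_const q)
  -- The product rule gives `β * 2B + B * β`. The parameter is then `18 * B ^ 2 * β ^ 2 / γ`, and
  -- the threshold `n * m * b / 2` produces the constant 144.
  have hsub := h.isStronglyLogConcave.hasSubgaussianMGF hγ hφm (L := 3 * B * β)
    (M := B * (2 * B)) (fun x y => ?_) (fun x => ?_) ?_
  · refine (hX.measure_abs_sum_ge_le hφm hsub (s := n * m / 2 * b) (by positivity)).trans_eq ?_
    congr 3
    rw [Real.coe_toNNReal _ (by positivity)]
    rcases Nat.eq_zero_or_pos n with rfl | hn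
    · simp
    · field_simp
      ring
  · have e : φ x - φ y = (w x - w y) * (f x - q) + w y * (f x - f y) := by
      simp only [hφ]; ring
    rw [e]
    refine (abs_add_le _ _).trans ?_
    rw [abs_mul, abs_mul]
    calc _ ≤ β * ‖x - y‖ * (2 * B) + B * (β * ‖x - y‖) := by
          gcongr
          · exact h.weight_lipschitz x y
          · exact hfq x
          · exact h.abs_weight_le y
          · exact hf x y
      _ = _ := by ring
  · rw [hφ, abs_mul]
    exact mul_le_mul (h.abs_weight_le x) (hfq x) (abs_nonneg _) hB.le
  · have hwi : Integrable w P :=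
      Integrable.of_bound hwm.aestronglyMeasurable B (ae_of_all _ h.abs_weight_le)
    have hwfi : Integrable (fun x => w x * f x) P := by
      refine Integrable.of_bound (by fun_prop) (B * B) (ae_of_all _ fun x => ?_)
      rw [Real.norm_eq_abs, abs_mul]
      exact mul_le_mul (h.abs_weight_le x) (hfB x) (abs_nonneg _) hB.le
    simp only [hφ, mul_sub]
    rw [integral_sub hwfi (hwi.mul_const q), integral_mul_const, hq, h.integral_eq f, ← hm]
    field_simp
    ring

/-- Uniform tail bound for self-normalised importance sampling. -/
lemma measure_snis_deviation_le (h : IsReweighting P Q w B β γ) {Ω : Type*} [MeasurableSpace Ω]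
    {μ : Measure Ω} [IsProbabilityMeasure μ] {n : ℕ} (hn : 0 < n) {X : Fin n → Ω → Euc d}
    (hX : IsIIDSample μ X P) {F : Set (Euc d → ℝ)} (hFB : ∀ f ∈ F, ∀ x, |f x| ≤ B)
    (hF : ∀ f ∈ F, ∀ x y, |f x - f y| ≤ β * ‖x - y‖) {b r : ℝ} (hb : 0 ≤ b) (hr : 0 ≤ r) :
    μ {ω | ∃ f ∈ F, b + 2 * r < |snis w (fun j => X j ω) f - ∫ x, f x ∂Q|} ≤
      2 * supCover r F * ENNReal.ofReal
        (Real.exp (-(γ * n * (∫ x, w x ∂P) ^ 2 * b ^ 2 / (144 * B ^ 2 * β ^ 2)))) +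
      ENNReal.ofReal (Real.exp (-(n * (∫ x, w x ∂P) ^ 2 / (2 * B ^ 2)))) := by
  have := h.isProbabilityMeasure_left
  have := h.isProbabilityMeasure_right
  have hβ := h.beta_pos
  have hn' : (0:ℝ) < n := by exact_mod_cast hn
  by_cases htop : supCover r F = ∞
  · rw [htop, ENNReal.mul_top (by simp), ENNReal.top_mul (by simp [Real.exp_pos]), top_add]
    exact le_top
  obtain ⟨C, hC, hCc, hCcov⟩ := exists_finset_supCover hr htop
  have hm0 := h.mean_pos
  set m := ∫ x, w x ∂P with hm
  have hint : ∀ f ∈ F, Integrable f Q := fun f hf =>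
    Integrable.of_bound (continuous_of_abs_sub_le hβ.le (hF f hf)).aestronglyMeasurable B
      (ae_of_all _ (hFB f hf))
  have hsub : {ω | ∃ f ∈ F, b + 2 * r < |snis w (fun j => X j ω) f - ∫ x, f x ∂Q|} ⊆
      (⋃ c ∈ C, {ω | n * m / 2 * b ≤ |∑ j, w (X j ω) * (c (X j ω) - ∫ x, c x ∂Q)|}) ∪
      {ω | ∑ l, w (X l ω) ≤ n * m / 2} := by
    rintro ω ⟨f, hf, hlt⟩
    by_cases hω : ∑ l, w (X l ω) ≤ n * m / 2
    · exact Or.inr hω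
    left
    push Not at hω
    have hs : 0 < ∑ l, w (X l ω) := lt_trans (by positivity) hω
    obtain ⟨c, hc, hfc⟩ := hCcov f hf
    refine Set.mem_biUnion hc ?_
    simp only [Set.mem_ofPred_eq]
    have h1 := abs_snis_sub_snis_le (x := fun j => X j ω) h.weight_nonneg hr hfc
    have h2 : |∫ x, f x ∂Q - ∫ x, c x ∂Q| ≤ r := by
      rw [← integral_sub (hint f hf) (hint c (hC hc))]
      have := norm_integral_le_of_norm_le_const (μ := Q)
        (f := fun x => f x - c x) (ae_of_all _ hfc)
      simpa using this
    -- Passing to the centre `c` costs `r` in the estimate and `r` in the integral. A total weight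
    -- above `n * m / 2` then turns the ratio bound into one on the numerator.
    have h3 : b < |snis w (fun j => X j ω) c - ∫ x, c x ∂Q| := by
      have e : snis w (fun j => X j ω) f - ∫ x, f x ∂Q =
          (snis w (fun j => X j ω) f - snis w (fun j => X j ω) c) +
          (snis w (fun j => X j ω) c - ∫ x, c x ∂Q) - (∫ x, f x ∂Q - ∫ x, c x ∂Q) := by ring
      rw [e] at hlt
      have h4 := abs_sub ((snis w (fun j => X j ω) f - snis w (fun j => X j ω) c) +
          (snis w (fun j => X j ω) c - ∫ x, c x ∂Q)) (∫ x, f x ∂Q - ∫ x, c x ∂Q)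
      have h5 := abs_add_le (snis w (fun j => X j ω) f - snis w (fun j => X j ω) c)
          (snis w (fun j => X j ω) c - ∫ x, c x ∂Q)
      linarith
    rw [snis_sub_const hs.ne', abs_div, abs_of_pos hs, lt_div_iff₀ hs] at h3
    nlinarith
  refine (measure_mono hsub).trans ((measure_union_le _ _).trans
    (add_le_add ?_ (h.measure_sum_weight_lt_le hX)))
  refine (measure_biUnion_finset_le _ _).trans ((Finset.sum_le_sum fun c hc =>
    h.measure_abs_sum_ge_le hX (hFB c (hC hc)) (hF c (hC hc)) hb).trans ?_)
  rw [Finset.sum_const, nsmul_eq_mul, ← mul_assoc, mul_comm (C.card : ℝ≥0∞) 2]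
  gcongr

end IsReweighting

/-! ### Deviation of the empirical discrepancy -/

/-- Boundedness of one family suffices, as the other stays within `t` of it; over an empty index
both real suprema are 0. -/
lemma abs_iSup_sub_iSup_le {ι : Type*} {a b : ι → ℝ} {t : ℝ} (ht : 0 ≤ t)
    (ha : BddAbove (Set.range a)) (h : ∀ i, |a i - b i| ≤ t) : |(⨆ i, a i) - ⨆ i, b i| ≤ t := by
  rcases isEmpty_or_nonempty ι with hι | hι
  · simpa [Real.iSup_of_isEmpty] using ht
  have hab : ∀ i, b i ≤ (⨆ i, a i) + t := fun i => by
    linarith [(abs_le.1 (h i)).1, le_ciSup ha i]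
  have hb : BddAbove (Set.range b) := ⟨_, by rintro _ ⟨i, rfl⟩; exact hab i⟩
  rw [abs_le]
  constructor
  · linarith [ciSup_le hab]
  · have : ∀ i, a i ≤ (⨆ i, b i) + t := fun i => by
      linarith [(abs_le.1 (h i)).2, le_ciSup hb i]
    linarith [ciSup_le this]

lemma abs_mmd_sub_empMMD_le {E : Type*} [MeasurableSpace E] {F : Set (E → ℝ)} {B : ℝ}
    (hFm : ∀ f ∈ F, Measurable f) (hFB : ∀ f ∈ F, ∀ x, |f x| ≤ B) {P Q : Measure E}
    [IsProbabilityMeasure P] [IsProbabilityMeasure Q] {g : E → E} (hg : Measurable g)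
    {w : E → ℝ} {n₁ n₂ : ℕ} {x : Fin n₁ → E} {x' : Fin n₂ → E} {a b : ℝ} (hab : 0 ≤ a + b)
    (h₁ : ∀ f ∈ F, |(1 / (n₁ : ℝ)) * ∑ i, f (g (x i)) - ∫ x, f (g x) ∂P| ≤ a)
    (h₂ : ∀ f ∈ F, |snis w x' f - ∫ x, f x ∂Q| ≤ b) :
    |mmd F (P.map g) Q - empMMD F w g x x'| ≤ a + b := by
  have hmap : ∀ f : F, ∫ x, f.1 x ∂(P.map g) = ∫ x, f.1 (g x) ∂P := fun f =>
    integral_map hg.aemeasurable (hFm f.1 f.2).aestronglyMeasurable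
  refine abs_iSup_sub_iSup_le hab ⟨2 * B, ?_⟩ fun f => ?_
  · rintro _ ⟨f, rfl⟩
    have := Measure.isProbabilityMeasure_map (μ := P) hg.aemeasurable
    have e1 := norm_integral_le_of_norm_le_const (μ := P.map g) (f := f.1) (ae_of_all _ (hFB f.1 f.2))
    have e2 := norm_integral_le_of_norm_le_const (μ := Q) (f := f.1) (ae_of_all _ (hFB f.1 f.2))
    simp only [probReal_univ, mul_one, Real.norm_eq_abs] at e1 e2
    exact (abs_sub _ _).trans (by linarith)
  · refine (abs_abs_sub_abs_le _ _).trans ?_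
    have e1 := h₁ f.1 f.2
    have e2 := h₂ f.1 f.2
    rw [snis] at e2
    rw [hmap f]
    rw [abs_le] at *
    constructor <;> linarith

/-- Two-parameter tail bound for the uniform deviation of the empirical discrepancy. -/
lemma IsReweighting.measure_mmd_deviation_le {d : ℕ} {P Q : Measure (Euc d)} {w : Euc d → ℝ}
    {B β γ : ℝ} (h : IsReweighting P Q w B β γ) {F : Set (Euc d → ℝ)}
    (hFB : ∀ f ∈ F, ∀ x, |f x| ≤ B) (hF : ∀ f ∈ F, ∀ x y, |f x - f y| ≤ β * ‖x - y‖)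
    {P' : Measure (Euc d)} [IsProbabilityMeasure P'] {G : Set (Euc d → Euc d)}
    (hG : IsPointwiseMeasurable G) {Ω : Type*} [MeasurableSpace Ω] {μ : Measure Ω}
    [IsProbabilityMeasure μ] {n₁ n₂ : ℕ} (hn₁ : 0 < n₁) (hn₂ : 0 < n₂) {X : Fin n₁ → Ω → Euc d}
    {X' : Fin n₂ → Ω → Euc d} (hX : IsIIDSample μ X P') (hX' : IsIIDSample μ X' P)
    {a r b s : ℝ} (ha : 0 ≤ a) (hr : 0 ≤ r) (hb : 0 ≤ b) (hs : 0 ≤ s) :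
    μ {ω | ∃ g ∈ G, 4 * (a + r) + (b + 2 * s) < |mmd F (P'.map g) Q -
        empMMD F w g (fun i => X i ω) (fun j => X' j ω)|} ≤
      2 * supCover s F * ENNReal.ofReal
        (Real.exp (-(γ * n₂ * (∫ x, w x ∂P) ^ 2 * b ^ 2 / (144 * B ^ 2 * β ^ 2)))) +
      ENNReal.ofReal (Real.exp (-(n₂ * (∫ x, w x ∂P) ^ 2 / (2 * B ^ 2)))) +
      8 * expCover P' n₁ r (compClass F G) *
        ENNReal.ofReal (Real.exp (-(n₁ * a ^ 2 / (2 * B ^ 2)))) := by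
  have := h.isProbabilityMeasure_right
  have hβ := h.beta_pos
  have hpm : IsPointwiseMeasurable (compClass F G) := IsPointwiseMeasurable.compClass hβ hG hF
  have hHB : ∀ k ∈ compClass F G, ∀ x, |k x| ≤ B := by
    rintro _ ⟨f, hf, g, -, rfl⟩ x
    exact hFB f hf (g x)
  -- The two samples meet only in this union bound, so nothing about their joint law is needed.
  refine le_trans (measure_mono ?_) ((measure_union_le _ _).trans (add_le_add
    (h.measure_snis_deviation_le hn₂ hX' hFB hF hb hs)
    (hX.measure_uniform_deviation_le hpm hn₁ h.bound_pos ha hr hHB)))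
  rintro ω ⟨g, hg, hlt⟩
  by_contra hcon
  simp only [Set.mem_union, Set.mem_ofPred_eq, not_or, not_exists, not_and, not_lt] at hcon
  refine absurd hlt (not_lt.2 ?_)
  exact abs_mmd_sub_empMMD_le
    (fun f hf => (continuous_of_abs_sub_le hβ.le (hF f hf)).measurable) hFB (hG.1 g hg)
    (by positivity) (fun f hf => hcon.2 (f ∘ g) (Set.mem_image2_of_mem hf hg))
    fun f hf => hcon.1 f hf

/-! ### The filtering recursion -/

lemma isProbabilityMeasure_bayes {d : ℕ} {P : Measure (Euc d)} {ℓ : Euc d → ℝ}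
    (h0 : ∫⁻ x, ENNReal.ofReal (ℓ x) ∂P ≠ 0) (ht : ∫⁻ x, ENNReal.ofReal (ℓ x) ∂P ≠ ∞) :
    IsProbabilityMeasure (bayes P ℓ) := by
  refine ⟨?_⟩
  rw [bayes, Measure.smul_apply, withDensity_apply _ MeasurableSet.univ, Measure.restrict_univ,
    smul_eq_mul, ENNReal.inv_mul_cancel h0 ht]

lemma integral_bayes {d : ℕ} {P : Measure (Euc d)} {ℓ : Euc d → ℝ} (hm : Measurable ℓ)
    (h0 : ∀ x, 0 ≤ ℓ x) (f : Euc d → ℝ) :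
    ∫ x, f x ∂(bayes P ℓ) = (∫ x, ℓ x * f x ∂P) / ∫ x, ℓ x ∂P := by
  rw [bayes, integral_smul_measure, integral_withDensity_eq_integral_toReal_smul
    hm.ennreal_ofReal (ae_of_all _ fun x => by simp), ENNReal.toReal_inv,
    integral_eq_lintegral_of_nonneg_ae (ae_of_all _ h0) hm.aestronglyMeasurable, smul_eq_mul,
    inv_mul_eq_div]
  simp only [ENNReal.toReal_ofReal (h0 _), smul_eq_mul]

lemma isProbabilityMeasure_forecast {d : ℕ} {k : ℕ → ℕ} (S : StateSpaceModel d k) (t : ℕ)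
    (Q : Measure (Euc d)) [IsProbabilityMeasure Q] : IsProbabilityMeasure (S.forecast t Q) := by
  have := Measure.isProbabilityMeasure_map (μ := Q) (S.measurable_M t).aemeasurable
  have : IsProbabilityMeasure
      ((volume : Measure (Euc d)).withDensity fun x => ENNReal.ofReal (S.pη (t + 1) x)) := by
    refine ⟨?_⟩
    rw [withDensity_apply _ MeasurableSet.univ, Measure.restrict_univ]
    exact (S.isDensity_pη (t + 1)).lintegral_eq_one
  rw [StateSpaceModel.forecast]
  infer_instance

lemma measurable_likelihood {d : ℕ} {k : ℕ → ℕ} (S : StateSpaceModel d k)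
    (y : (t : ℕ) → Euc (k t)) (t : ℕ) : Measurable (S.likelihood y t) :=
  (S.isDensity_pε t).measurable.comp ((S.measurable_H t).const_sub (y t))

lemma likelihood_nonneg {d : ℕ} {k : ℕ → ℕ} (S : StateSpaceModel d k)
    (y : (t : ℕ) → Euc (k t)) (t : ℕ) (x : Euc d) : 0 ≤ S.likelihood y t x :=
  (S.isDensity_pε t).nonneg _

lemma abs_sub_le_of_gradient_le {d : ℕ} {f : Euc d → ℝ} {β : ℝ} (hf : Differentiable ℝ f)
    (h : ∀ x, ‖gradient f x‖ ≤ β) (x y : Euc d) : |f x - f y| ≤ β * ‖x - y‖ := by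
  refine convex_univ.norm_image_sub_le_of_norm_fderiv_le (𝕜 := ℝ) (fun z _ => hf z) (fun z _ => ?_)
    (Set.mem_univ y) (Set.mem_univ x)
  have := h z
  rwa [gradient, LinearIsometryEquiv.norm_map] at this

section Model

variable {d : ℕ} {k : ℕ → ℕ} {S : StateSpaceModel d k} {y : (t : ℕ) → Euc (k t)}
  {c : ℕ → ℝ} {T : ℕ} {F : Set (Euc d → ℝ)} {B β : ℝ} {γ : ℕ → ℝ}

/-- The bound on the weights bounds the likelihood by `B / c t`, so the normalising constant in
Bayes' rule is finite. -/
lemma Assumptions.lintegral_likelihood_ne_top (hA : Assumptions S y c T F B β γ) {t : ℕ}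
    (ht : t ∈ Set.Icc 1 T) (hc : 0 < c t) (P : Measure (Euc d)) [IsProbabilityMeasure P] :
    ∫⁻ x, ENNReal.ofReal (S.likelihood y t x) ∂P ≠ ∞ := by
  have hle : ∀ x, ENNReal.ofReal (S.likelihood y t x) ≤ ENNReal.ofReal (B / c t) := fun x => by
    refine ENNReal.ofReal_le_ofReal ((le_div_iff₀' hc).2 ?_)
    exact (le_abs_self _).trans (hA.weight_le t ht x)
  refine ne_top_of_le_ne_top ?_ (lintegral_mono hle)
  simp

lemma Assumptions.isProbabilityMeasure_posterior (hA : Assumptions S y c T F B β γ)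
    (hc : ∀ t ∈ Set.Icc 1 T, 0 < c t)
    (hy : ∀ t ∈ Set.Icc 1 T, 0 < ∫⁻ x, ENNReal.ofReal (S.likelihood y t x) ∂(S.prior y t)) :
    ∀ t ≤ T, IsProbabilityMeasure (S.posterior y t)
  | 0, _ => S.isProbabilityMeasure_init
  | t + 1, ht => by
    have := Assumptions.isProbabilityMeasure_posterior hA hc hy t (by omega)
    have hmem : t + 1 ∈ Set.Icc 1 T := ⟨by omega, ht⟩
    have := isProbabilityMeasure_forecast S t (S.posterior y t)
    exact isProbabilityMeasure_bayes (hy _ hmem).ne'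
      (hA.lintegral_likelihood_ne_top hmem (hc _ hmem) (S.forecast t (S.posterior y t)))

/-- The analysis step of the filter is a reweighting of the prior by the importance weights. -/
lemma Assumptions.isReweighting (hA : Assumptions S y c T F B β γ)
    (hc : ∀ t ∈ Set.Icc 1 T, 0 < c t) (hβ : 0 < β)
    (hy : ∀ t ∈ Set.Icc 1 T, 0 < ∫⁻ x, ENNReal.ofReal (S.likelihood y t x) ∂(S.prior y t))
    {t : ℕ} (ht : t ∈ Set.Icc 1 T) :
    IsReweighting (S.prior y t) (S.posterior y t) (S.weight y c t) B β (γ t) := by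
  obtain ⟨s, rfl⟩ : ∃ s, t = s + 1 := ⟨t - 1, by have := ht.1; omega⟩
  have hct := hc _ ht
  have := hA.isProbabilityMeasure_posterior hc hy s (by have := ht.2; omega)
  have hP : IsProbabilityMeasure (S.prior y (s + 1)) :=
    isProbabilityMeasure_forecast S s (S.posterior y s)
  have hfin := hA.lintegral_likelihood_ne_top ht hct (S.prior y (s + 1))
  have hℓ : 0 < ∫ x, S.likelihood y (s + 1) x ∂(S.prior y (s + 1)) := by
    rw [integral_eq_lintegral_of_nonneg_ae (ae_of_all _ (likelihood_nonneg S y _))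
      (measurable_likelihood S y _).aestronglyMeasurable]
    exact ENNReal.toReal_pos (hy _ ht).ne' hfin
  refine
    { isProbabilityMeasure_left := hP
      isProbabilityMeasure_right := hA.isProbabilityMeasure_posterior hc hy _ ht.2
      isStronglyLogConcave := hA.stronglyLogConcave _ ht
      gamma_pos := hA.gamma_pos _ ht
      beta_pos := hβ
      weight_nonneg := fun x => mul_nonneg hct.le (likelihood_nonneg S y _ x)
      weight_le := fun x => (le_abs_self _).trans (hA.weight_le _ ht x)
      weight_lipschitz := abs_sub_le_of_gradient_le (hA.differentiable_weight _ ht)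
        (hA.gradient_weight_le _ ht)
      mean_pos := ?_
      integral_eq := fun f => ?_ }
  · simp only [StateSpaceModel.weight]
    rw [integral_const_mul]
    positivity
  · have e : S.posterior y (s + 1) = bayes (S.prior y (s + 1)) (S.likelihood y (s + 1)) := rfl
    rw [e, integral_bayes (measurable_likelihood S y _) (likelihood_nonneg S y _)]
    simp only [StateSpaceModel.weight, mul_assoc]
    -- The constant `c t` cancels: the normalised ratio is the same for weights and likelihood.
    rw [integral_const_mul, integral_const_mul, mul_div_mul_left _ _ hct.ne']

end Model

/-! ### Calibration of the tail bounds -/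

/-- An exponent of `κ * ℓ` times `log N` absorbs the covering number `N` and the prefactor `A`. The
margin comes from `log N ≥ log 2 > 0.69`, which is why `N ≥ 2` is required. -/
lemma mul_exp_neg_log_le {A κ ℓ N e : ℝ} (hN : 2 ≤ N) (hκ : 1 ≤ κ * ℓ) (hA : 0 < A)
    (h : Real.log A + ℓ ≤ 0.69 * (κ * ℓ - 1)) (he : κ * ℓ * Real.log N ≤ e) :
    A * N * Real.exp (-e) ≤ Real.exp (-ℓ) := by
  have hN0 : 0 < N := by linarith
  have hlog : 0.69 ≤ Real.log N := by
    have := Real.log_two_gt_d9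
    have := Real.log_le_log (by norm_num) hN
    linarith
  calc A * N * Real.exp (-e) = Real.exp (Real.log A + Real.log N + -e) := by
        rw [Real.exp_add, Real.exp_add, Real.exp_log hA, Real.exp_log hN0]
    _ ≤ Real.exp (-ℓ) := Real.exp_le_exp.2 (by nlinarith)

/-- Handles the terms without a growing covering number; these terms determine the minimal sample
sizes in (b). -/
lemma exists_nat_mul_exp_neg_le {A κ δ : ℝ} (hκ : 0 < κ) (hδ : 0 < δ) :
    ∃ n₀ : ℕ, ∀ n : ℕ, n₀ ≤ n → A * Real.exp (-(n * κ)) ≤ δ := by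
  have h1 : Tendsto (fun n : ℕ => (n : ℝ) * κ) atTop atTop :=
    tendsto_natCast_atTop_atTop.atTop_mul_const hκ
  have h2 : Tendsto (fun n : ℕ => A * Real.exp (-(n * κ))) atTop (𝓝 0) := by
    simpa using (Real.tendsto_exp_neg_atTop_nhds_zero.comp h1).const_mul A
  exact eventually_atTop.1 ((h2.eventually (ge_mem_nhds hδ)))

/-- With the threshold equal to the importance sampling part of `statError`, all model constants
cancel and only `ℓ` times the log covering number remains; 4096 is `64 ^ 2`. -/
lemma importance_exponent_eq {B β γ m ℓ x N : ℝ} (hB : 0 < B) (hβ : 0 < β) (hγ : 0 < γ)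
    (hm : 0 < m) (hℓ : 0 ≤ ℓ) (hx : 0 ≤ x) (hN : 0 < N) :
    γ * N * m ^ 2 * (64 * B * β / (√γ * m) * √(x / N) * √ℓ) ^ 2 / (144 * B ^ 2 * β ^ 2) =
      4096 / 144 * ℓ * x := by
  rw [mul_pow, mul_pow, div_pow, mul_pow (√γ), Real.sq_sqrt hγ.le, Real.sq_sqrt hℓ,
    Real.sq_sqrt (by positivity)]
  field_simp
  ring

lemma empirical_exponent_eq {B ℓ x N : ℝ} (hB : 0 < B) (hℓ : 0 ≤ ℓ) (hx : 0 ≤ x) (hN : 0 < N) :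
    N * (64 * B * √(x / N) * √ℓ) ^ 2 / (2 * B ^ 2) = 2048 * ℓ * x := by
  rw [mul_pow, mul_pow, Real.sq_sqrt hℓ, Real.sq_sqrt (by positivity)]
  field_simp
  ring

set_option maxHeartbeats 800000 in
/-- Choice of the deviation parameters for the high-probability bounds. -/
lemma exists_tail_parameters {B β γ m δ r₀ : ℝ} (hB : 0 < B) (hβ : 0 < β) (hγ : 0 < γ)
    (hm : 0 < m) (hδ : 0 < δ) (hδ1 : δ < 1) (hr₀ : 0 < r₀) :
    ∃ n₁ n₂ : ℕ, 0 < n₁ ∧ 0 < n₂ ∧ ∀ N₁ N₂ : ℕ, n₁ ≤ N₁ → n₂ ≤ N₂ → ∀ K₂ K₁ L ε : ℝ,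
      1 ≤ K₂ → K₂ ≤ K₁ → 1 ≤ L → 0 < ε → (K₂ < 2 → K₂ = 1 ∧ 6 * r₀ ≤ ε) → ∀ R : ℝ,
      R = (64 * B * β / (√γ * m) * √(Real.log K₂ / N₂) +
        64 * B * √((Real.log K₁ + Real.log L) / N₁)) * √(Real.log (3 / δ)) → ε ≤ R →
      ∃ a b : ℝ, 0 ≤ a ∧ 0 ≤ b ∧ 4 * (a + ε / 16) + (b + 2 * (ε / 6)) ≤ R ∧
        2 * K₂ * Real.exp (-(γ * N₂ * m ^ 2 * b ^ 2 / (144 * B ^ 2 * β ^ 2))) +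
        Real.exp (-(N₂ * m ^ 2 / (2 * B ^ 2))) +
        8 * (K₁ * L) * Real.exp (-(N₁ * a ^ 2 / (2 * B ^ 2))) ≤ δ := by
  -- The prefactors are those of the degenerate case: `8 * (K₁ * L) < 16` when `K₁ * L < 2`, and `2
  -- * K₂ = 2`. There the deviation parameters are at least `r₀ / 2`.
  obtain ⟨p₁, hp₁⟩ := exists_nat_mul_exp_neg_le (A := 16) (κ := (r₀ / 2) ^ 2 / (2 * B ^ 2))
    (δ := δ / 3) (by positivity) (by positivity)
  obtain ⟨p₂, hp₂⟩ := exists_nat_mul_exp_neg_le (A := 2)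
    (κ := γ * m ^ 2 * (r₀ / 2) ^ 2 / (144 * B ^ 2 * β ^ 2)) (δ := δ / 3) (by positivity)
    (by positivity)
  obtain ⟨p₃, hp₃⟩ := exists_nat_mul_exp_neg_le (A := 1) (κ := m ^ 2 / (2 * B ^ 2))
    (δ := δ / 3) (by positivity) (by positivity)
  refine ⟨p₁ + 1, p₂ + p₃ + 1, by omega, by omega, ?_⟩
  intro N₁ N₂ hN₁ hN₂ K₂ K₁ L ε hK₂ hK₁ hL hε hsmall R hR hεR
  have hN₁' : (0:ℝ) < N₁ := by exact_mod_cast (show 0 < N₁ by omega)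
  have hN₂' : (0:ℝ) < N₂ := by exact_mod_cast (show 0 < N₂ by omega)
  set ℓ := Real.log (3 / δ) with hℓ
  have hδℓ : Real.exp (-ℓ) = δ / 3 := by
    rw [hℓ, Real.exp_neg, Real.exp_log (by positivity), inv_div]
  have hℓ1 : 1 ≤ ℓ := by
    rw [hℓ, Real.le_log_iff_exp_le (by positivity)]
    have := Real.exp_one_lt_d9
    rw [le_div_iff₀ hδ]
    nlinarith
  have hlK₂ : 0 ≤ Real.log K₂ := Real.log_nonneg hK₂
  have hlK₁ : 0 ≤ Real.log K₁ := Real.log_nonneg (hK₂.trans hK₁)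
  have hlL : 0 ≤ Real.log L := Real.log_nonneg hL
  have hlog : Real.log (K₁ * L) = Real.log K₁ + Real.log L :=
    Real.log_mul (by linarith) (by linarith)
  set R₁ := 64 * B * β / (√γ * m) * √(Real.log K₂ / N₂) * √ℓ with hR₁
  set R₂ := 64 * B * √((Real.log K₁ + Real.log L) / N₁) * √ℓ with hR₂
  have hRR : R = R₁ + R₂ := by rw [hR, add_mul]
  have hR₁0 : 0 ≤ R₁ := by positivity
  have hR₂0 : 0 ≤ R₂ := by positivity
  have hR₁sq : γ * N₂ * m ^ 2 * R₁ ^ 2 / (144 * B ^ 2 * β ^ 2) = 4096 / 144 * ℓ * Real.log K₂ :=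
    importance_exponent_eq hB hβ hγ hm (by linarith) hlK₂ hN₂'
  have hR₂sq : N₁ * R₂ ^ 2 / (2 * B ^ 2) = 2048 * ℓ * Real.log (K₁ * L) := by
    rw [hlog]
    exact empirical_exponent_eq hB (by linarith) (by linarith) hN₁'
  have hT₂ : Real.exp (-(N₂ * m ^ 2 / (2 * B ^ 2))) ≤ δ / 3 := by
    have := hp₃ N₂ (by omega)
    rwa [one_mul, ← mul_div_assoc] at this
  have hlog2 := Real.log_two_lt_d9
  have hlog8 : Real.log 8 ≤ 2.08 := by
    rw [show (8:ℝ) = 2 ^ 3 by norm_num, Real.log_pow]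
    push_cast; linarith
  have hT₃ : 2 ≤ K₁ * L → 8 * (K₁ * L) * Real.exp (-(N₁ * (R₂ / 12) ^ 2 / (2 * B ^ 2))) ≤ δ / 3 := by
    intro h2
    rw [← hδℓ]
    refine mul_exp_neg_log_le (κ := 14) h2 (by linarith) (by norm_num) (by linarith) ?_
    have : N₁ * (R₂ / 12) ^ 2 / (2 * B ^ 2) = 2048 / 144 * ℓ * Real.log (K₁ * L) := by
      calc _ = N₁ * R₂ ^ 2 / (2 * B ^ 2) / 144 := by ring
        _ = _ := by rw [hR₂sq]; ring
    rw [this]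
    have : 0 ≤ ℓ * Real.log (K₁ * L) := mul_nonneg (by linarith) (by linarith)
    nlinarith
  by_cases hK : K₂ < 2
  · obtain ⟨hK1, hr⟩ := hsmall hK
    have hR₁z : R₁ = 0 := by rw [hR₁, hK1]; simp
    have hRr : r₀ / 2 ≤ R / 12 := by linarith
    -- Since `ε ≤ R`, the discretisation terms use `7 / 12 * R` and leave `4 * a + b ≤ 5 / 12 * R`.
    -- Here `R₁ = 0`, so `b` must be taken from `R₂`; its tail is small because `R ≥ ε ≥ 6 * r₀`.
    refine ⟨R / 12, R / 12, by linarith, by linarith, by linarith, ?_⟩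
    have hT₁ : 2 * K₂ * Real.exp (-(γ * N₂ * m ^ 2 * (R / 12) ^ 2 / (144 * B ^ 2 * β ^ 2))) ≤
        δ / 3 := by
      refine le_trans ?_ (hp₂ N₂ (by omega))
      rw [hK1, mul_one]
      have : N₂ * (γ * m ^ 2 * (r₀ / 2) ^ 2 / (144 * B ^ 2 * β ^ 2)) ≤
          γ * N₂ * m ^ 2 * (R / 12) ^ 2 / (144 * B ^ 2 * β ^ 2) := by
        rw [← mul_div_assoc]
        gcongr ?_ / _
        calc N₂ * (γ * m ^ 2 * (r₀ / 2) ^ 2) = γ * N₂ * m ^ 2 * (r₀ / 2) ^ 2 := by ring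
          _ ≤ _ := by gcongr
      gcongr
    have hT₃' : 8 * (K₁ * L) * Real.exp (-(N₁ * (R / 12) ^ 2 / (2 * B ^ 2))) ≤ δ / 3 := by
      by_cases h2 : 2 ≤ K₁ * L
      · rw [hRR, hR₁z, zero_add]
        exact hT₃ h2
      · refine le_trans ?_ (hp₁ N₁ (by omega))
        rw [← mul_div_assoc]
        push Not at h2
        gcongr
        linarith
    linarith
  · push Not at hK
    have h2 : 2 ≤ K₁ * L := by nlinarith
    -- Each error draws on its own summand of `R`. The resulting factors `2048 / 144 > 14` and `25 /
    -- 144 * (4096 / 144) > 4.9` are the values of `κ`.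
    refine ⟨R₂ / 12, 5 / 12 * R₁, by positivity, by positivity, by linarith, ?_⟩
    have hT₁ : 2 * K₂ * Real.exp (-(γ * N₂ * m ^ 2 * (5 / 12 * R₁) ^ 2 / (144 * B ^ 2 * β ^ 2))) ≤
        δ / 3 := by
      rw [← hδℓ]
      refine mul_exp_neg_log_le (κ := 4.9) hK (by linarith) (by norm_num) (by linarith) ?_
      have : γ * N₂ * m ^ 2 * (5 / 12 * R₁) ^ 2 / (144 * B ^ 2 * β ^ 2) =
          25 / 144 * (4096 / 144) * ℓ * Real.log K₂ := by
        calc _ = 25 / 144 * (γ * N₂ * m ^ 2 * R₁ ^ 2 / (144 * B ^ 2 * β ^ 2)) := by ring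
          _ = _ := by rw [hR₁sq]; ring
      rw [this]
      have : 0 ≤ ℓ * Real.log K₂ := mul_nonneg (by linarith) hlK₂
      nlinarith
    have := hT₃ h2
    linarith

/-! ### Tail and high-probability bounds for a reweighting. -/

lemma chiSq_nonneg {E : Type*} [MeasurableSpace E] (Q P : Measure E) : 0 ≤ chiSq Q P :=
  integral_nonneg fun _ => sq_nonneg _

lemma one_le_toReal {x : ℝ≥0∞} (h : 1 ≤ x) (hx : x ≠ ∞) : 1 ≤ x.toReal := by
  simpa using ENNReal.toReal_mono hx h

lemma expCover_compClass_le_of_lipschitz {d : ℕ} {F : Set (Euc d → ℝ)} {G : Set (Euc d → Euc d)}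
    {β : ℝ} (hβ : 0 < β) (hF : ∀ f ∈ F, ∀ x y, |f x - f y| ≤ β * ‖x - y‖) (P : Measure (Euc d))
    [IsProbabilityMeasure P] {n : ℕ} (hn : 0 < n) {ε : ℝ} (hε : 0 < ε) :
    expCover P n (ε / 16) (compClass F G) ≤
      supCover (ε / 32) F * expCover P n (ε / (32 * β)) G := by
  have := expCover_compClass_le (G := G) P hn hβ.le (r := ε / 32) (s := ε / (32 * β))
    (by positivity) (by positivity) hF
  rwa [show ε / 32 + β * (ε / (32 * β)) = ε / 16 by field_simp; ring] at this

namespace IsReweighting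

variable {d : ℕ} {P Q : Measure (Euc d)} {w : Euc d → ℝ} {B β γ : ℝ} {F : Set (Euc d → ℝ)}
  {P' : Measure (Euc d)} {G : Set (Euc d → Euc d)} {Ω : Type*} [MeasurableSpace Ω]

/-- Tail bound for the supremal deviation of the empirical discrepancy. -/
lemma measure_iSup_mmd_deviation_le (h : IsReweighting P Q w B β γ)
    (hFB : ∀ f ∈ F, ∀ x, |f x| ≤ B) (hF : ∀ f ∈ F, ∀ x y, |f x - f y| ≤ β * ‖x - y‖)
    [IsProbabilityMeasure P'] (hG : IsPointwiseMeasurable G) {μ : Measure Ω}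
    [IsProbabilityMeasure μ] {N₁ N₂ : ℕ} (hN₁ : 0 < N₁) (hN₂ : 0 < N₂) {X : Fin N₁ → Ω → Euc d}
    {X' : Fin N₂ → Ω → Euc d} (hX : IsIIDSample μ X P') (hX' : IsIIDSample μ X' P)
    {ε : ℝ} (hε : 0 < ε) :
    μ {ω | ε + 12 * B * (chiSq Q P + 1) / N₂ <
        ⨆ g : G, |mmd F (P'.map g.1) Q - empMMD F w g.1 (fun i => X i ω) (fun j => X' j ω)|}
      ≤ 2 * supCover (ε / 6) F * ENNReal.ofReal (Real.exp
            (-(γ * N₂ * (∫ x, w x ∂P) ^ 2 * ε ^ 2 / (5760 * B ^ 2 * β ^ 2))))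
        + 2 * ENNReal.ofReal (Real.exp (-(N₂ * (∫ x, w x ∂P) ^ 2 / (2 * B ^ 2))))
        + 8 * expCover P' N₁ (ε / 16) (compClass F G) *
            ENNReal.ofReal (Real.exp (-(N₁ * ε ^ 2 / (2048 * B ^ 2)))) := by
  have hB := h.bound_pos
  have hβ := h.beta_pos
  have hγ := h.gamma_pos
  have hbias : 0 ≤ 12 * B * (chiSq Q P + 1) / N₂ := by
    have := chiSq_nonneg Q P
    positivity
  -- The choice exhausts the budget: `4 * (ε / 16 + ε / 16) + (ε / 6 + 2 * (ε / 6)) = ε`. The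
  -- exponents obtained, with 5184 and 512, are stronger than the stated ones.
  have key := h.measure_mmd_deviation_le hFB hF hG hN₁ hN₂ hX hX' (a := ε / 16) (r := ε / 16)
    (b := ε / 6) (s := ε / 6) (by positivity) (by positivity) (by positivity) (by positivity)
  refine (measure_mono ?_).trans (key.trans ?_)
  · intro ω hω
    simp only [Set.mem_ofPred_eq] at hω ⊢
    rcases isEmpty_or_nonempty G with hGe | hGe
    · rw [Real.iSup_of_isEmpty] at hω
      linarith
    · obtain ⟨g, hg⟩ := exists_lt_of_lt_ciSup hω
      exact ⟨g.1, g.2, lt_of_le_of_lt (by linarith) hg⟩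
  · gcongr ?_ + ?_ + ?_
    · gcongr 2 * supCover (ε / 6) F * ENNReal.ofReal (Real.exp (-?_))
      rw [div_le_div_iff₀ (by positivity) (by positivity)]
      have : 0 ≤ γ * N₂ * (∫ x, w x ∂P) ^ 2 * ε ^ 2 * (B ^ 2 * β ^ 2) := by positivity
      nlinarith
    · exact le_mul_of_one_le_left' one_le_two
    · gcongr 8 * expCover P' N₁ (ε / 16) (compClass F G) * ENNReal.ofReal (Real.exp (-?_))
      rw [div_le_div_iff₀ (by positivity) (by positivity)]
      have : 0 ≤ N₁ * ε ^ 2 * B ^ 2 := by positivity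
      nlinarith

/-- High-probability bound for the deviation of the empirical discrepancy by the statistical
error. -/
lemma exists_measure_mmd_deviation_statError_le (h : IsReweighting P Q w B β γ)
    (hFB : ∀ f ∈ F, ∀ x, |f x| ≤ B) (hF : ∀ f ∈ F, ∀ x y, |f x - f y| ≤ β * ‖x - y‖)
    (hFn : F.Nontrivial) [IsProbabilityMeasure P'] (hG : IsPointwiseMeasurable G)
    {δ : ℝ} (hδ : 0 < δ) :
    ∃ n₁ n₂ : ℕ, ∀ N₁ N₂ : ℕ, n₁ ≤ N₁ → n₂ ≤ N₂ →
      ∀ (Ω : Type u) [MeasurableSpace Ω] (μ : Measure Ω) [IsProbabilityMeasure μ]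
        (X : Fin N₁ → Ω → Euc d) (X' : Fin N₂ → Ω → Euc d),
        IsIIDSample μ X P' → IsIIDSample μ X' P →
      ∀ ε : ℝ, 0 < ε → supCover (ε / 32) F ≠ ∞ → expCover P' N₁ (ε / (32 * β)) G ≠ ∞ →
        ε ≤ statError F G P' B β γ (∫ x, w x ∂P) N₁ N₂ δ ε →
        μ {ω | ∃ g ∈ G, statError F G P' B β γ (∫ x, w x ∂P) N₁ N₂ δ ε <
          |mmd F (P'.map g) Q - empMMD F w g (fun i => X i ω) (fun j => X' j ω)|} ≤
        ENNReal.ofReal δ := by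
  have hB := h.bound_pos
  have hβ := h.beta_pos
  rcases le_or_gt 1 δ with hδ1 | hδ1
  · refine ⟨0, 0, fun N₁ N₂ _ _ Ω _ μ _ X X' _ _ ε _ _ _ _ => prob_le_one.trans ?_⟩
    rw [← ENNReal.ofReal_one]
    exact ENNReal.ofReal_le_ofReal hδ1
  obtain ⟨r₀, hr₀, hr₀2⟩ := exists_two_le_supCover hFn
  obtain ⟨n₁, n₂, hn₁, hn₂, hpar⟩ :=
    exists_tail_parameters hB hβ h.gamma_pos h.mean_pos hδ hδ1 hr₀
  refine ⟨n₁, n₂, fun N₁ N₂ hN₁ hN₂ Ω _ μ _ X X' hX hX' ε hε hS hE hεR => ?_⟩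
  rcases G.eq_empty_or_nonempty with rfl | hGn
  · simp
  have hS6le : supCover (ε / 6) F ≤ supCover (ε / 32) F := supCover_anti (by linarith) F
  have hS6 : supCover (ε / 6) F ≠ ∞ := ne_top_of_le_ne_top hS hS6le
  set K₂ := (supCover (ε / 6) F).toReal with hK₂
  set K₁ := (supCover (ε / 32) F).toReal with hK₁
  set L := (expCover P' N₁ (ε / (32 * β)) G).toReal with hL
  have hK₂1 : 1 ≤ K₂ := one_le_toReal (one_le_supCover hFn.nonempty) hS6
  have hL1 : 1 ≤ L := one_le_toReal (one_le_expCover hGn) hE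
  have hsmall : K₂ < 2 → K₂ = 1 ∧ 6 * r₀ ≤ ε := by
    intro hlt
    have hlt' : supCover (ε / 6) F < 2 := by
      rw [← ENNReal.ofReal_toReal hS6, ← ENNReal.ofReal_ofNat]
      exact (ENNReal.ofReal_lt_ofReal_iff (by norm_num)).2 hlt
    refine ⟨by rw [hK₂, supCover_eq_one_of_lt_two hFn.nonempty hlt', ENNReal.toReal_one], ?_⟩
    by_contra! hcon
    -- For `ε < 6 * r₀` monotonicity in the radius would give a covering number of at least 2; this
    -- is where two distinct test functions matter.
    exact absurd (hr₀2.trans (supCover_anti (by linarith) F)) (not_le.2 hlt')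
  obtain ⟨a, b, ha, hb, hab, htail⟩ := hpar N₁ N₂ hN₁ hN₂ K₂ K₁ L ε hK₂1
    (ENNReal.toReal_mono hS hS6le) hL1 hε hsmall _ rfl hεR
  have key := h.measure_mmd_deviation_le hFB hF hG (hn₁.trans_le hN₁) (hn₂.trans_le hN₂) hX hX'
    (r := ε / 16) (s := ε / 6) ha (by positivity) hb (by positivity)
  refine (measure_mono ?_).trans (key.trans (le_trans ?_ (ENNReal.ofReal_le_ofReal htail)))
  · rintro ω ⟨g, hg, hlt⟩
    exact ⟨g, hg, hab.trans_lt hlt⟩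
  · have hcov := expCover_compClass_le_of_lipschitz (G := G) hβ hF P' (hn₁.trans_le hN₁) hε
    have hK₂0 : 0 ≤ K₂ := by linarith
    have hK₁0 : 0 ≤ K₁ := ENNReal.toReal_nonneg
    have hL0 : 0 ≤ L := by linarith
    rw [ENNReal.ofReal_add (by positivity) (by positivity),
      ENNReal.ofReal_add (by positivity) (by positivity), ENNReal.ofReal_mul (by positivity),
      ENNReal.ofReal_mul (by positivity), ENNReal.ofReal_mul (by positivity),
      ENNReal.ofReal_mul (by positivity), ENNReal.ofReal_mul (by positivity), hK₂, hK₁, hL,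
      ENNReal.ofReal_toReal hS6, ENNReal.ofReal_toReal hS, ENNReal.ofReal_toReal hE,
      ENNReal.ofReal_ofNat, ENNReal.ofReal_ofNat]
    gcongr

end IsReweighting

end ATPF

/-! ### The theorem for the filtering recursion. -/

open ATPF in
theorem theorem2 {d : ℕ} {k : ℕ → ℕ} (S : StateSpaceModel d k) (y : (t : ℕ) → Euc (k t))
    (c : ℕ → ℝ) (T : ℕ) (F : Set (Euc d → ℝ)) (B β : ℝ) (γ : ℕ → ℝ)
    (hc : ∀ t ∈ Set.Icc 1 T, 0 < c t) (hβ : 0 < β)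
    (hy : ∀ t ∈ Set.Icc 1 T, 0 < ∫⁻ x, ENNReal.ofReal (S.likelihood y t x) ∂(S.prior y t))
    (hA : Assumptions S y c T F B β γ)
    (t : ℕ) (ht : t ∈ Set.Icc 1 T)
    (Phat : Measure (Euc d)) [IsProbabilityMeasure Phat]
    (G : Set (Euc d → Euc d)) (hG : IsPointwiseMeasurable G) :
    -- tail bounds
    (∀ N₁ N₂ : ℕ, 0 < N₁ → 0 < N₂ →
      ∀ (Ω : Type u) [MeasurableSpace Ω] (μ : Measure Ω) [IsProbabilityMeasure μ]
        (X : Fin N₁ → Ω → Euc d) (X' : Fin N₂ → Ω → Euc d),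
        IsIIDSample μ X Phat → IsIIDSample μ X' (S.prior y t) →
      ∀ ε : ℝ, 0 < ε →
        μ {ω | ε + 12 * B * (chiSq (S.posterior y t) (S.prior y t) + 1) / N₂ <
            ⨆ g : G, |mmd F (Phat.map g.1) (S.posterior y t) -
              empMMD F (S.weight y c t) g.1 (fun i => X i ω) (fun j => X' j ω)|}
          ≤ 2 * supCover (ε / 6) F * ENNReal.ofReal (Real.exp
                (-(γ t * N₂ * (∫ x, S.weight y c t x ∂(S.prior y t)) ^ 2 * ε ^ 2 /
                  (5760 * B ^ 2 * β ^ 2))))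
            + 2 * ENNReal.ofReal (Real.exp
                (-(N₂ * (∫ x, S.weight y c t x ∂(S.prior y t)) ^ 2 / (2 * B ^ 2))))
            + 8 * expCover Phat N₁ (ε / 16) (compClass F G) *
                ENNReal.ofReal (Real.exp (-(N₁ * ε ^ 2 / (2048 * B ^ 2)))) ∧
        2 * supCover (ε / 6) F * ENNReal.ofReal (Real.exp
                (-(γ t * N₂ * (∫ x, S.weight y c t x ∂(S.prior y t)) ^ 2 * ε ^ 2 /
                  (5760 * B ^ 2 * β ^ 2))))
            + 2 * ENNReal.ofReal (Real.exp
                (-(N₂ * (∫ x, S.weight y c t x ∂(S.prior y t)) ^ 2 / (2 * B ^ 2))))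
            + 8 * expCover Phat N₁ (ε / 16) (compClass F G) *
                ENNReal.ofReal (Real.exp (-(N₁ * ε ^ 2 / (2048 * B ^ 2))))
          ≤ 2 * supCover (ε / 6) F * ENNReal.ofReal (Real.exp
                (-(γ t * N₂ * (∫ x, S.weight y c t x ∂(S.prior y t)) ^ 2 * ε ^ 2 /
                  (5760 * B ^ 2 * β ^ 2))))
            + 2 * ENNReal.ofReal (Real.exp
                (-(N₂ * (∫ x, S.weight y c t x ∂(S.prior y t)) ^ 2 / (2 * B ^ 2))))
            + 8 * (supCover (ε / 32) F * expCover Phat N₁ (ε / (32 * β)) G) *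
                ENNReal.ofReal (Real.exp (-(N₁ * ε ^ 2 / (2048 * B ^ 2))))) ∧
    -- high-probability bounds
    (F.Nontrivial → ∀ δ : ℝ, 0 < δ → ∃ n₁ n₂ : ℕ, ∀ N₁ N₂ : ℕ, n₁ ≤ N₁ → n₂ ≤ N₂ →
      ∀ (Ω : Type u) [MeasurableSpace Ω] (μ : Measure Ω) [IsProbabilityMeasure μ]
        (X : Fin N₁ → Ω → Euc d) (X' : Fin N₂ → Ω → Euc d),
        IsIIDSample μ X Phat → IsIIDSample μ X' (S.prior y t) →
      ∀ ε : ℝ, 0 < ε → supCover (ε / 32) F ≠ ∞ → expCover Phat N₁ (ε / (32 * β)) G ≠ ∞ →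
        ε ≤ statError F G Phat B β (γ t) (∫ x, S.weight y c t x ∂(S.prior y t)) N₁ N₂ δ ε →
        μ {ω | ¬ (
            (∀ g ∈ G, mmd F (Phat.map g) (S.posterior y t) ≤
              empMMD F (S.weight y c t) g (fun i => X i ω) (fun j => X' j ω)
                + 12 * B * (chiSq (S.posterior y t) (S.prior y t) + 1) / N₂
                + statError F G Phat B β (γ t) (∫ x, S.weight y c t x ∂(S.prior y t))
                    N₁ N₂ δ ε) ∧
            (∀ ghat ∈ G,
              IsMinOn (fun g => empMMD F (S.weight y c t) g (fun i => X i ω) (fun j => X' j ω))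
                G ghat →
              mmd F (Phat.map ghat) (S.posterior y t) ≤
                (⨅ g : G, mmd F (Phat.map g.1) (S.posterior y t))
                  + 24 * B * (chiSq (S.posterior y t) (S.prior y t) + 1) / N₂
                  + 2 * statError F G Phat B β (γ t) (∫ x, S.weight y c t x ∂(S.prior y t))
                    N₁ N₂ δ ε))}
          ≤ ENNReal.ofReal δ) := by
  have hR := hA.isReweighting hc hβ hy ht
  have hF : ∀ f ∈ F, ∀ x y, |f x - f y| ≤ β * ‖x - y‖ := fun f hf =>
    abs_sub_le_of_gradient_le (hA.differentiable_test f hf) (hA.gradient_test_le f hf)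
  refine ⟨fun N₁ N₂ hN₁ hN₂ Ω _ μ _ X X' hX hX' ε hε =>
    ⟨hR.measure_iSup_mmd_deviation_le hA.test_le hF hG hN₁ hN₂ hX hX' hε, ?_⟩,
    fun hFn δ hδ => ?_⟩
  · have := expCover_compClass_le_of_lipschitz (G := G) hβ hF Phat hN₁ hε
    gcongr
  obtain ⟨n₁, n₂, hn⟩ :=
    hR.exists_measure_mmd_deviation_statError_le (P' := Phat) hA.test_le hF hFn hG hδ
  refine ⟨n₁, n₂, fun N₁ N₂ hN₁ hN₂ Ω _ μ _ X X' hX hX' ε hε hS hE hεR =>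
    (measure_mono ?_).trans (hn N₁ N₂ hN₁ hN₂ Ω μ X X' hX hX' ε hε hS hE hεR)⟩
  intro ω hω
  simp only [Set.mem_ofPred_eq] at hω ⊢
  -- Outside the deviation event every `g` in `G` satisfies the two-sided bound `hcon`, and both
  -- claims follow deterministically.
  by_contra! hcon
  set R := statError F G Phat B β (γ t) (∫ x, S.weight y c t x ∂(S.prior y t)) N₁ N₂ δ ε
  have hB := hR.bound_pos
  have hbias : 0 ≤ B * (chiSq (S.posterior y t) (S.prior y t) + 1) / N₂ := by
    have := chiSq_nonneg (S.posterior y t) (S.prior y t)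
    positivity
  have e12 : 12 * B * (chiSq (S.posterior y t) (S.prior y t) + 1) / N₂ =
      12 * (B * (chiSq (S.posterior y t) (S.prior y t) + 1) / N₂) := by ring
  have e24 : 24 * B * (chiSq (S.posterior y t) (S.prior y t) + 1) / N₂ =
      24 * (B * (chiSq (S.posterior y t) (S.prior y t) + 1) / N₂) := by ring
  refine hω ⟨fun g hg => ?_, fun ghat hghat hmin => ?_⟩
  · rw [e12]
    linarith [(abs_le.1 (hcon g hg)).2]
  · have : Nonempty G := ⟨⟨ghat, hghat⟩⟩
    -- The comparison passes from `ghat` to its empirical value, to that of `g` by minimality, and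
    -- back to `g`, using the deviation bound twice.
    have hinf : mmd F (Phat.map ghat) (S.posterior y t) - 2 * R ≤
        ⨅ g : G, mmd F (Phat.map g.1) (S.posterior y t) := by
      refine le_ciInf fun g => ?_
      have h1 := (abs_le.1 (hcon ghat hghat)).2
      have h2 := (abs_le.1 (hcon g.1 g.2)).1
      have h3 := isMinOn_iff.1 hmin g.1 g.2
      linarith
    rw [e24]
    linarith
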